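/- Let $n\ge 3$ and $\ell\ge 1$ be integers and $p$ a prime. Let $S\subseteq\mathbb{Z}_n\setminus\{0\}$ with $-S=S$, put $S_0=S\cup\{0\}$, and let $\Gamma=\mathrm{Cay}(\mathbb{Z}_n,S)$ be the graph on $\mathbb{Z}_n$ in which $x,y$ are adjacent if and only if $x-y\in S$. A perfect code in $\Gamma$ is a set $D$ of vertices such that every vertex of $\Gamma$ is at distance at most $1$ from exactly one vertex in $D$. For a subset $X$ of a finite abelian group $G$, the subgroup of periods of $X$ is $G_X=\{a\in G: X+a=X\}$. We say that $X$ is aperiodic if $G_X=\{0\}$, and that $X$ is $H$-periodic if $G_X=H$. For a subgroup $H$ of $G$, $X/H$ denotes the image of $X$ in $G/H$. An admissible subgroup series of $G$ of length $2t$ ($t\ge 1$) associated with $X$ is a series of subgroups $H_0<H_1<\cdots<H_{2t-1}\le H_{2t}=G$ such that either (i) $H_0=\{0\}$, $X$ is aperiodic, and - (T1) $(X/H_{2i}-X/H_{2i})\cap(H_{2i+1}/H_{2i})=\{0\}$ for $0\le i\le t-1$, - (T2) $X/H_{2i-1}$ is $(H_{2i}/H_{2i-1})$-periodic for $1\le i\le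 t$, - (T3) $|X/H_{2t-1}|=|G/H_{2t-1}|$, and $|X/H_{2i}|=|X/H_{2i+1}|$ for $0\le i\le t-1$; or (ii) $H_0\ne\{0\}$, $X$ is $H_0$-periodic, and $X/H_0$ satisfies (T1), (T2), (T3) in $G/H_0$ with respect to the series $H_0/H_0<H_1/H_0<\cdots<H_{2t-1}/H_0\le H_{2t}/H_0=G/H_0$. The set $X$ is a pyramidal set of $G$ if $0\in X$ and there is an admissible subgroup series of $G$ associated with $X$. Suppose that $\Gamma$ is connected, non-complete and of degree $p^\ell-1$. Then $\Gamma$ has a perfect code if and only if $p^\ell$ divides $n$ and $S_0$ is a pyramidal set of $\mathbb{Z}_n$. Moreover, suppose that $p^\ell$ divides $n$, that $S_0$ is pyramidal and aperiodic, and that the longest admissible subgroup series of $\mathbb{Z}_n$ associated with $S_0$ has length $2t$. Let $\langle p^\ell\rangle$ be the subgroup of $\mathbb{Z}_n$ generated by $p^\ell$. (a) If $(S_0-S_0)\cap\langle p^\ell\rangle=\{0\}$, then $\langle p^\ell\rangle$ is a perfect code in $\Gamma$. If $t=1$, it is the only perfect code in $\Gamma$ containing $0$. If $t>1$, there are perfect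 codes in $\Gamma$ containing $0$ which are not subgroups of $\mathbb{Z}_n$. (b) If $(S_0-S_0)\cap\langle p^\ell\rangle\ne\{0\}$, then there are perfect codes in $\Gamma$ containing $0$, but no subgroup of $\mathbb{Z}_n$ (in particular not $\langle p^\ell\rangle$) is a perfect code in $\Gamma$. -/

import Mathlib

open scoped Pointwise

section PerfectCodes

variable {V : Type*}

/-- A perfect `e`-code of a graph: every vertex is at distance at most `e` from exactly one
element of `D`. (`edist` is the extended distance, infinite between different components.) -/
def IsPerfectECode (Γ : SimpleGraph V) (e : ℕ) (D : Set V) : Prop :=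
  ∀ v : V, ∃! d : V, d ∈ D ∧ Γ.edist v d ≤ e

/-- A perfect code is a perfect `1`-code. -/
def IsPerfectCode (Γ : SimpleGraph V) (D : Set V) : Prop :=
  IsPerfectECode Γ 1 D

end PerfectCodes

section Pyramidal

variable {G : Type*} [AddCommGroup G]

/-- The extended connection set `S₀ = S ∪ {0}`. -/
def extendedSet (S : Set G) : Set G := insert 0 S

/-- The subgroup of periods `G_X = {a | a + X = X}` of `X`. -/
def periodSubgroup (X : Set G) : AddSubgroup G := AddAction.stabilizer G X

/-- `X` is aperiodic if its only period is `0`. -/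
def IsAperiodicSet (X : Set G) : Prop := periodSubgroup X = ⊥

/-- `X` is `H`-periodic: `H` is (exactly) the subgroup of periods of `X`. -/
def IsPeriodicWith (X : Set G) (H : AddSubgroup G) : Prop := periodSubgroup X = H

/-- `X/H`, the image of the set `X` under the projection `G → G/H`. -/
def quotSet (X : Set G) (H : AddSubgroup G) : Set (G ⧸ H) := QuotientAddGroup.mk' H '' X

/-- `K/H` as a subgroup of `G/H` (used for `H ≤ K`). -/
def quotSubgroup (K H : AddSubgroup G) : AddSubgroup (G ⧸ H) := K.map (QuotientAddGroup.mk' H)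

/-- The three pyramidal conditions for a set `X` in a finite abelian group `G` with respect to the
subgroups `H 0, H 1, …, H (2 * t)`; only these values of `H` are used. -/
structure PyramidalConditions (X : Set G) (t : ℕ) (H : ℕ → AddSubgroup G) : Prop where
  /-- `(X/H_{2i} - X/H_{2i}) ∩ (H_{2i+1}/H_{2i}) = {0}` for `0 ≤ i ≤ t - 1` -/
  T1 : ∀ i < t, (quotSet X (H (2 * i)) - quotSet X (H (2 * i))) ∩
    (quotSubgroup (H (2 * i + 1)) (H (2 * i)) : Set (G ⧸ H (2 * i))) = {0}
  /-- `X/H_{2i-1}` is `(H_{2i}/H_{2i-1})`-periodic for `1 ≤ i ≤ t` -/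
  T2 : ∀ i, 1 ≤ i → i ≤ t → IsPeriodicWith (quotSet X (H (2 * i - 1)))
    (quotSubgroup (H (2 * i)) (H (2 * i - 1)))
  /-- `|X/H_{2t-1}| = |G/H_{2t-1}|` -/
  T3_top : (quotSet X (H (2 * t - 1))).ncard = Nat.card (G ⧸ H (2 * t - 1))
  /-- `|X/H_{2i}| = |X/H_{2i+1}|` for `0 ≤ i ≤ t - 1` -/
  T3 : ∀ i < t, (quotSet X (H (2 * i))).ncard = (quotSet X (H (2 * i + 1))).ncard

/-- `H_0 < H_1 < ⋯ < H_{2t-1} ≤ H_{2t} = G` is an admissible subgroup series (of length `2t`) of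
the finite abelian group `G` associated with `X`. -/
structure IsAdmissibleSeries (X : Set G) (t : ℕ) (H : ℕ → AddSubgroup G) : Prop where
  one_le : 1 ≤ t
  lt_succ : ∀ j, j + 1 < 2 * t → H j < H (j + 1)
  le_last : H (2 * t - 1) ≤ H (2 * t)
  last_eq : H (2 * t) = ⊤
  cases :
    (H 0 = ⊥ ∧ IsAperiodicSet X ∧ PyramidalConditions X t H) ∨
    (H 0 ≠ ⊥ ∧ IsPeriodicWith X (H 0) ∧
      PyramidalConditions (quotSet X (H 0)) t (fun j => quotSubgroup (H j) (H 0)))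

/-- `X` is a pyramidal set of `G`. -/
def IsPyramidal (X : Set G) : Prop :=
  0 ∈ X ∧ ∃ (t : ℕ) (H : ℕ → AddSubgroup G), IsAdmissibleSeries X t H

/-- `k` is the length of a longest admissible subgroup series associated with `X`. -/
def IsLongestAdmissibleLength (X : Set G) (k : ℕ) : Prop :=
  IsGreatest {j : ℕ | ∃ (t : ℕ) (H : ℕ → AddSubgroup G), j = 2 * t ∧ IsAdmissibleSeries X t H} k

end Pyramidal

/-! ### Periods of a set, and saturation by a subgroup -/

section Periods

variable {G Q : Type*} [AddCommGroup G] [AddCommGroup Q]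

/-! A set `D` is a perfect code exactly when `S₀ + D` is a factorization of `ZMod n`. So the
question is when a set `X` with `p ^ ℓ` elements has a complement in a cyclic group.

An admissible series gives a complement from the top down: `X + H_{2t-1}` is everything, T2 gives `X
+ H_{2i+1} = X + H_{2i+2}`, and T1 makes `X/H_{2i} → X/H_{2i+1}` injective, so complements pull
back.

Conversely, let an aperiodic `X` tile. By `Tiles.exists_subgroup` some `H ≠ 0` meets `X - X` only in
`0` while `X/H` still tiles. If a prime `q ≠ p` divides the order of the group, the `q`-torsion will
do, because `X` may be replaced by `q • X` (`IsFactorization.nsmul`). In a cyclic `p`-group one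
factor is periodic (`IsFactorization.periodic_of_card_eq_pow`, by vanishing sums of roots of unity);
it must be the complement, and its periods serve as `H`. For a maximal such `H`, either `X + H` is
everything or `X/H` is periodic; in the latter case pass to its periods and repeat.

A subgroup code has order `n / p ^ ℓ`, so it is `C = ⟨p ^ ℓ⟩`; this decides which case has a
subgroup code. If `t > 1`, moving one element of a complement of `X + H 1` by a period gives two
codes, at most one of them a subgroup. If `t = 1`, no `X/N` with `N < C` is periodic, since
otherwise `0 < N` would start a longer series; `IsFactorization.eq_subgroup` then shows that `C` is
the only complement containing `0`. -/

theorem mem_periodSubgroup {X : Set G} {a : G} :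
    a ∈ periodSubgroup X ↔ ∀ b, a + b ∈ X ↔ b ∈ X :=
  AddAction.mem_stabilizer_set

theorem mem_periodSubgroup_of_finite {X : Set G} (hX : X.Finite) {a : G} :
    a ∈ periodSubgroup X ↔ ∀ b ∈ X, a + b ∈ X :=
  AddAction.mem_stabilizer_set' hX

theorem le_periodSubgroup_iff {X : Set G} {H : AddSubgroup G} :
    H ≤ periodSubgroup X ↔ ∀ h ∈ H, ∀ x ∈ X, h + x ∈ X := by
  refine ⟨fun hH h hh x hx => (mem_periodSubgroup.1 (hH hh) x).2 hx, fun hH h hh => ?_⟩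
  refine mem_periodSubgroup.2 fun b => ⟨fun hb => ?_, hH h hh b⟩
  simpa using hH (-h) (neg_mem hh) _ hb

theorem mem_add_subgroup {X : Set G} {H : AddSubgroup G} {g : G} :
    g ∈ X + (H : Set G) ↔ ∃ x ∈ X, g - x ∈ H := by
  rw [Set.mem_add]
  refine ⟨?_, fun ⟨x, hx, h⟩ => ⟨x, hx, g - x, h, by abel⟩⟩
  rintro ⟨x, hx, h, hh, rfl⟩
  exact ⟨x, hx, by simpa using hh⟩

theorem subset_add_subgroup (X : Set G) (H : AddSubgroup G) : X ⊆ X + (H : Set G) :=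
  fun x hx => mem_add_subgroup.2 ⟨x, hx, by simp⟩

theorem le_periodSubgroup_add (X : Set G) (H : AddSubgroup G) :
    H ≤ periodSubgroup (X + (H : Set G)) := by
  refine le_periodSubgroup_iff.2 fun h hh g hg => ?_
  obtain ⟨x, hx, hgx⟩ := mem_add_subgroup.1 hg
  exact mem_add_subgroup.2 ⟨x, hx, by simpa [add_sub_assoc] using add_mem hh hgx⟩

theorem add_subgroup_eq_of_le_period {X : Set G} {H : AddSubgroup G}
    (h : H ≤ periodSubgroup X) : X + (H : Set G) = X := by
  refine Set.Subset.antisymm (fun g hg => ?_) (subset_add_subgroup X H)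
  obtain ⟨x, hx, hgx⟩ := mem_add_subgroup.1 hg
  simpa using le_periodSubgroup_iff.1 h _ hgx x hx

theorem add_subgroup_add_subgroup {X : Set G} {H K : AddSubgroup G} (h : H ≤ K) :
    X + (H : Set G) + (K : Set G) = X + (K : Set G) := by
  rw [add_assoc]
  congr 1
  refine Set.Subset.antisymm ?_ fun k hk => ⟨0, zero_mem H, k, hk, by simp⟩
  rintro _ ⟨a, ha, b, hb, rfl⟩
  exact add_mem (h ha) hb

theorem add_subgroup_congr_of_le_period {X : Set G} {H K : AddSubgroup G} (h : H ≤ K)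
    (hK : K ≤ periodSubgroup (X + (H : Set G))) :
    X + (H : Set G) = X + (K : Set G) := by
  rw [← add_subgroup_add_subgroup h, add_subgroup_eq_of_le_period hK]

theorem preimage_image_eq_add_ker (f : G →+ Q) (X : Set G) :
    f ⁻¹' (f '' X) = X + (f.ker : Set G) := by
  ext g
  rw [mem_add_subgroup]
  simp only [Set.mem_preimage, Set.mem_image, AddMonoidHom.mem_ker, map_sub, sub_eq_zero]
  exact ⟨fun ⟨x, hx, h⟩ => ⟨x, hx, h.symm⟩, fun ⟨x, hx, h⟩ => ⟨x, hx, h.symm⟩⟩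

theorem comap_periodSubgroup {f : G →+ Q} (hf : Function.Surjective f) (Y : Set Q) :
    (periodSubgroup Y).comap f = periodSubgroup (f ⁻¹' Y) := by
  ext a
  simp only [AddSubgroup.mem_comap, mem_periodSubgroup, Set.mem_preimage, map_add]
  exact ⟨fun h b => h _, fun h b => by obtain ⟨c, rfl⟩ := hf b; exact h c⟩

theorem preimage_image_add_subgroup (f : G →+ Q) (X : Set G)
    (N : AddSubgroup Q) :
    f ⁻¹' (f '' X + (N : Set Q)) = X + ((N.comap f : AddSubgroup G) : Set G) := by
  ext g
  rw [mem_add_subgroup, Set.mem_preimage, mem_add_subgroup]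
  simp

end Periods

/-! ### Factorizations and their behaviour under quotients -/

section Factorization

variable {G Q : Type*} [AddCommGroup G] [AddCommGroup Q]

/-- Every element of `G` is uniquely a sum of an element of `A` and an element of `B`. -/
structure IsFactorization (A B : Set G) : Prop where
  cover : ∀ g, ∃ a ∈ A, ∃ b ∈ B, a + b = g
  inj : ∀ a ∈ A, ∀ a' ∈ A, ∀ b ∈ B, ∀ b' ∈ B, a + b = a' + b' → a = a'

/-- `A` is a direct factor of `G`. -/
def Tiles (A : Set G) : Prop := ∃ B, IsFactorization A B

namespace IsFactorization

variable {A B : Set G}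

theorem symm (h : IsFactorization A B) : IsFactorization B A where
  cover g := by
    obtain ⟨a, ha, b, hb, e⟩ := h.cover g
    exact ⟨b, hb, a, ha, by rw [add_comm, e]⟩
  inj b hb b' hb' a ha a' ha' e := by
    have := h.inj a ha a' ha' b hb b' hb' (by rw [add_comm a, add_comm a', e])
    subst this
    exact add_right_cancel e

theorem translate (h : IsFactorization A B) (c : G) :
    IsFactorization A ((fun b => b + c) '' B) where
  cover g := by
    obtain ⟨a, ha, b, hb, e⟩ := h.cover (g - c)
    exact ⟨a, ha, b + c, ⟨b, hb, rfl⟩, by rw [← add_assoc, e]; abel⟩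
  inj := by
    rintro a ha a' ha' _ ⟨b, hb, rfl⟩ _ ⟨b', hb', rfl⟩ e
    exact h.inj a ha a' ha' b hb b' hb' (by simpa [← add_assoc] using e)

theorem bijective (h : IsFactorization A B) :
    Function.Bijective (fun q : A × B => (q.1 + q.2 : G)) := by
  refine ⟨?_, fun g => ?_⟩
  · rintro ⟨⟨a, ha⟩, ⟨b, hb⟩⟩ ⟨⟨a', ha'⟩, ⟨b', hb'⟩⟩ e
    have e' : a + b = a' + b' := e
    obtain rfl := h.inj a ha a' ha' b hb b' hb' e'
    obtain rfl := add_left_cancel e'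
    rfl
  · obtain ⟨a, ha, b, hb, e⟩ := h.cover g
    exact ⟨(⟨a, ha⟩, ⟨b, hb⟩), e⟩

theorem ncard_mul_ncard (h : IsFactorization A B) : A.ncard * B.ncard = Nat.card G := by
  rw [← Nat.card_congr (Equiv.ofBijective _ h.bijective), Nat.card_prod, Nat.card_coe_set_eq,
    Nat.card_coe_set_eq]

theorem of_cover [Finite G] (h : ∀ g, ∃ a ∈ A, ∃ b ∈ B, a + b = g)
    (hc : A.ncard * B.ncard = Nat.card G) : IsFactorization A B where
  cover := h
  inj a ha a' ha' b hb b' hb' e := by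
    have hs : Function.Surjective (fun q : A × B => (q.1 + q.2 : G)) := fun g => by
      obtain ⟨a, ha, b, hb, e⟩ := h g
      exact ⟨(⟨a, ha⟩, ⟨b, hb⟩), e⟩
    have hb := (Nat.bijective_iff_surjective_and_card _).2
      ⟨hs, by rw [Nat.card_prod, Nat.card_coe_set_eq, Nat.card_coe_set_eq, hc]⟩
    have := @hb.1 (⟨a, ha⟩, ⟨b, ‹_›⟩) (⟨a', ha'⟩, ⟨b', hb'⟩) e
    simpa using congrArg (fun q : A × B => (q.1 : G)) this

theorem of_inj [Finite G]
    (h : ∀ a ∈ A, ∀ a' ∈ A, ∀ b ∈ B, ∀ b' ∈ B, a + b = a' + b' → a = a')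
    (hc : A.ncard * B.ncard = Nat.card G) : IsFactorization A B where
  inj := h
  cover g := by
    have hi : Function.Injective (fun q : A × B => (q.1 + q.2 : G)) := by
      rintro ⟨⟨a, ha⟩, ⟨b, hb⟩⟩ ⟨⟨a', ha'⟩, ⟨b', hb'⟩⟩ e
      have e' : a + b = a' + b' := e
      obtain rfl := h a ha a' ha' b hb b' hb' e'
      obtain rfl := add_left_cancel e'
      rfl
    have hb := (Nat.bijective_iff_injective_and_card _).2
      ⟨hi, by rw [Nat.card_prod, Nat.card_coe_set_eq, Nat.card_coe_set_eq, hc]⟩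
    obtain ⟨⟨⟨a, ha⟩, ⟨b, hb⟩⟩, e⟩ := hb.2 g
    exact ⟨a, ha, b, hb, e⟩

/-- Factors are maximal: a factor containing a complement of the same set equals it. -/
theorem eq_of_subset {B' : Set G} (h : IsFactorization A B) (h' : IsFactorization A B')
    (hs : B ⊆ B') : B = B' := by
  refine hs.antisymm fun d hd => ?_
  obtain ⟨x, hx, -⟩ := h.cover 0
  obtain ⟨a, ha, b, hb, e⟩ := h.cover (x + d)
  obtain rfl := h'.inj a ha x hx b (hs hb) d hd e
  obtain rfl := add_left_cancel e
  exact hb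

theorem preimage {f : G →+ Q} {D : Set Q} (hA : Set.InjOn f A)
    (h : IsFactorization (f '' A) D) : IsFactorization A (f ⁻¹' D) where
  cover g := by
    obtain ⟨_, ⟨a, ha, rfl⟩, d, hd, e⟩ := h.cover (f g)
    exact ⟨a, ha, g - a, by rw [Set.mem_preimage, map_sub, ← e]; simpa using hd, by abel⟩
  inj a ha a' ha' b hb b' hb' e :=
    hA ha ha' (h.inj _ ⟨a, ha, rfl⟩ _ ⟨a', ha', rfl⟩ _ hb _ hb' (by rw [← map_add, e, map_add]))

theorem image {f : G →+ Q} (hf : Function.Surjective f) (hA : f.ker ≤ periodSubgroup A)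
    (h : IsFactorization A B) : IsFactorization (f '' A) (f '' B) where
  cover q := by
    obtain ⟨g, rfl⟩ := hf q
    obtain ⟨a, ha, b, hb, rfl⟩ := h.cover g
    exact ⟨f a, ⟨a, ha, rfl⟩, f b, ⟨b, hb, rfl⟩, (map_add f a b).symm⟩
  inj := by
    rintro _ ⟨a, ha, rfl⟩ _ ⟨a', ha', rfl⟩ _ ⟨b, hb, rfl⟩ _ ⟨b', hb', rfl⟩ e
    have hk : (a + b) - (a' + b') ∈ f.ker := by
      rw [AddMonoidHom.mem_ker, map_sub, map_add, map_add, e, sub_self]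
    have := h.symm.inj b hb b' hb' a ha _ (le_periodSubgroup_iff.1 hA _ hk a' ha') (by abel)
    subst this
    exact add_right_cancel e

/-- Two elements of `A` that differ by a period of `B` would give one element two decompositions. -/
theorem injOn_of_ker_le {f : G →+ Q} (hB : f.ker ≤ periodSubgroup B)
    (h : IsFactorization A B) : Set.InjOn f A := by
  intro a ha a' ha' e
  obtain ⟨a₀, ha₀, b, hb, -⟩ := h.cover 0
  have hk : a - a' ∈ f.ker := by rw [AddMonoidHom.mem_ker, map_sub, e, sub_self]
  exact h.inj a ha a' ha' b hb _ (le_periodSubgroup_iff.1 hB _ hk b hb) (by abel)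

end IsFactorization

/-- Complements push forward because `f ⁻¹' Y` is a union of cosets of the kernel; they lift through
any section of `f`. -/
theorem tiles_preimage_iff {f : G →+ Q} (hf : Function.Surjective f) (Y : Set Q) :
    Tiles (f ⁻¹' Y) ↔ Tiles Y := by
  constructor
  · rintro ⟨B, hB⟩
    refine ⟨f '' B, ?_⟩
    rw [← Set.image_preimage_eq Y hf]
    refine hB.image hf (le_periodSubgroup_iff.2 fun h hh x hx => ?_)
    rw [AddMonoidHom.mem_ker] at hh
    simpa [hh] using hx
  · rintro ⟨D, hD⟩
    refine ⟨Function.surjInv hf '' D, fun g => ?_, ?_⟩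
    · obtain ⟨y, hy, d, hd, e⟩ := hD.cover (f g)
      refine ⟨g - Function.surjInv hf d, ?_, _, ⟨d, hd, rfl⟩, by abel⟩
      rw [Set.mem_preimage, map_sub, Function.surjInv_eq hf, ← e]
      simpa using hy
    · rintro a ha a' ha' _ ⟨d, hd, rfl⟩ _ ⟨d', hd', rfl⟩ e
      have e' := congrArg f e
      simp only [map_add, Function.surjInv_eq hf] at e'
      obtain rfl := hD.symm.inj d hd d' hd' _ ha _ ha' (by rw [add_comm, e', add_comm])
      exact add_right_cancel e

theorem tiles_image_iff {f : G →+ Q} (hf : Function.Surjective f) (X : Set G) :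
    Tiles (f '' X) ↔ Tiles (X + (f.ker : Set G)) := by
  rw [← tiles_preimage_iff hf, preimage_image_eq_add_ker]

theorem tiles_univ : Tiles (Set.univ : Set G) :=
  ⟨{0}, fun g => ⟨g, trivial, 0, rfl, add_zero g⟩, fun a _ a' _ b hb b' hb' e => by
    rw [Set.mem_singleton_iff] at hb hb'
    simpa [hb, hb'] using e⟩

/-- The projection `G ⧸ H → G ⧸ K` is injective on the image of `X`, so the full preimage of a
complement is a complement. -/
theorem Tiles.of_add_subgroup {X : Set G} {H K : AddSubgroup G} (hHK : H ≤ K)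
    (hX : ∀ x ∈ X, ∀ y ∈ X, x - y ∈ K → x - y ∈ H) (h : Tiles (X + (K : Set G))) :
    Tiles (X + (H : Set G)) := by
  have hf := QuotientAddGroup.mk'_surjective H
  rw [← QuotientAddGroup.ker_mk' H, ← tiles_image_iff hf]
  let φ : G ⧸ H →+ G ⧸ K := QuotientAddGroup.map H K (AddMonoidHom.id G) hHK
  have hcomp : φ.comp (QuotientAddGroup.mk' H) = QuotientAddGroup.mk' K := by ext; rfl
  rw [← QuotientAddGroup.ker_mk' K, ← tiles_image_iff (QuotientAddGroup.mk'_surjective K),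
    ← hcomp, AddMonoidHom.coe_comp, Set.image_comp] at h
  obtain ⟨D, hD⟩ := h
  refine ⟨_, hD.preimage ?_⟩
  rintro _ ⟨x, hx, rfl⟩ _ ⟨y, hy, rfl⟩ e
  have e' : (x : G ⧸ K) = y := e
  rw [QuotientAddGroup.eq_iff_sub_mem] at e'
  exact QuotientAddGroup.eq_iff_sub_mem.2 (hX x hx y hy e')

theorem ncard_add_subgroup [Finite G] (X : Set G) (H : AddSubgroup G) :
    (X + (H : Set G)).ncard = (quotSet X H).ncard * Nat.card H := by
  have h : X + (H : Set G) = QuotientAddGroup.mk ⁻¹' (quotSet X H) := by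
    have := preimage_image_eq_add_ker (QuotientAddGroup.mk' H) X
    rw [QuotientAddGroup.ker_mk'] at this
    exact this.symm
  rw [h, ← Nat.card_coe_set_eq,
    Nat.card_congr (QuotientAddGroup.preimageMkEquivAddSubgroupProdSet H _), Nat.card_prod,
    Nat.card_coe_set_eq, mul_comm]

theorem ncard_quotSet_eq {X : Set G} {H K : AddSubgroup G} (hHK : H ≤ K)
    (hX : ∀ x ∈ X, ∀ y ∈ X, x - y ∈ K → x - y ∈ H) :
    (quotSet X H).ncard = (quotSet X K).ncard := by
  let φ : G ⧸ H →+ G ⧸ K := QuotientAddGroup.map H K (AddMonoidHom.id G) hHK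
  have hcomp : quotSet X K = φ '' quotSet X H := by
    rw [quotSet, quotSet, ← Set.image_comp]; rfl
  rw [hcomp, Set.InjOn.ncard_image]
  rintro _ ⟨x, hx, rfl⟩ _ ⟨y, hy, rfl⟩ e
  have e' : (x : G ⧸ K) = y := e
  rw [QuotientAddGroup.eq_iff_sub_mem] at e'
  exact QuotientAddGroup.eq_iff_sub_mem.2 (hX x hx y hy e')

end Factorization

/-! ### Replacing a factor by a multiple of it -/

section Replacement

variable {G : Type*} [AddCommGroup G] [Finite G]

/-- In the group algebra over `ZMod q`, write `α`, `β`, `γ` for the sums over `A`, `B`, `G`.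
Frobenius makes `α ^ q` the sum over `q • A`, while `α ^ q * β = α ^ (q - 1) * γ = |A| ^ (q - 1) γ =
γ` by Fermat. So `q • A + B` covers `G`, and counting gives the rest. -/
theorem IsFactorization.nsmul_prime {A B : Set G} (h : IsFactorization A B) {q : ℕ}
    (hq : q.Prime) (hA : A.ncard.Coprime q) :
    Set.InjOn (fun a => q • a) A ∧ IsFactorization ((fun a => q • a) '' A) B := by
  classical
  have := Fact.mk hq
  have hcover : ∀ g, ∃ a ∈ (fun a => q • a) '' A, ∃ b ∈ B, a + b = g := by
    have := Fintype.ofFinite G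
    let s := A.toFinite.toFinset
    let t := B.toFinite.toFinset
    let α : AddMonoidAlgebra (ZMod q) G := ∑ a ∈ s, AddMonoidAlgebra.single a 1
    let β : AddMonoidAlgebra (ZMod q) G := ∑ b ∈ t, AddMonoidAlgebra.single b 1
    let γ : AddMonoidAlgebra (ZMod q) G := ∑ g : G, AddMonoidAlgebra.single g 1
    have hαβ : α * β = γ := by
      simp only [α, β, γ, Finset.sum_mul_sum, AddMonoidAlgebra.single_mul_single, mul_one]
      rw [← Finset.sum_product']
      refine Finset.sum_bij (fun x _ => x.1 + x.2) (fun _ _ => Finset.mem_univ _) ?_ ?_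
        (fun _ _ => rfl)
      · rintro ⟨a, b⟩ hab ⟨a', b'⟩ hab' e
        simp only [Finset.mem_product, s, t, Set.Finite.mem_toFinset] at hab hab'
        simp only at e
        obtain rfl := h.inj a hab.1 a' hab'.1 b hab.2 b' hab'.2 e
        rw [add_left_cancel e]
      · intro g _
        obtain ⟨a, ha, b, hb, e⟩ := h.cover g
        exact ⟨(a, b), by simp [s, t, ha, hb], e⟩
    have hsingle : ∀ a : G, AddMonoidAlgebra.single a (1 : ZMod q) * γ = γ := by
      intro a
      simp only [γ, Finset.mul_sum, AddMonoidAlgebra.single_mul_single, mul_one]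
      exact Equiv.sum_comp (Equiv.addLeft a) (fun g => AddMonoidAlgebra.single g (1 : ZMod q))
    have hαγ : α * γ = (A.ncard : AddMonoidAlgebra (ZMod q) G) * γ := by
      simp only [α, Finset.sum_mul, hsingle, Finset.sum_const, nsmul_eq_mul]
      rw [Set.ncard_eq_toFinset_card A]
    have hpow : ∀ k : ℕ, α ^ k * γ = (A.ncard : AddMonoidAlgebra (ZMod q) G) ^ k * γ := by
      intro k
      induction k with
      | zero => simp
      | succ k ih =>
        rw [pow_succ, mul_assoc, hαγ, mul_left_comm, ih]
        ring
    have hone : (A.ncard : AddMonoidAlgebra (ZMod q) G) ^ (q - 1) = 1 := by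
      have h0 : (A.ncard : ZMod q) ≠ 0 := by
        rw [Ne, ZMod.natCast_eq_zero_iff]
        exact (Nat.Prime.coprime_iff_not_dvd hq).1 hA.symm
      have := congrArg (algebraMap (ZMod q) (AddMonoidAlgebra (ZMod q) G))
        (ZMod.pow_card_sub_one_eq_one h0)
      rwa [map_pow, map_natCast, map_one] at this
    have : CharP (AddMonoidAlgebra (ZMod q) G) q :=
      charP_of_injective_algebraMap (FaithfulSMul.algebraMap_injective (ZMod q) _) q
    have hfrob : α ^ q = ∑ a ∈ s, AddMonoidAlgebra.single (q • a) 1 := by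
      simp only [α]
      rw [sum_pow_char q]
      simp [AddMonoidAlgebra.single_pow]
    have hmain : α ^ q * β = γ := by
      rw [← pow_sub_one_mul hq.ne_zero, mul_assoc, hαβ, hpow, hone, one_mul]
    intro g
    by_contra! hg
    have h1 : γ.coeff g = 1 := by
      simp [γ, AddMonoidAlgebra.coeff_single, Finsupp.single_apply]
    have h2 : (α ^ q * β).coeff g = 0 := by
      rw [hfrob]
      simp only [β, Finset.sum_mul_sum, AddMonoidAlgebra.single_mul_single, mul_one]
      simp only [AddMonoidAlgebra.coeff_sum, Finsupp.finsetSum_apply,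
        AddMonoidAlgebra.coeff_single, Finsupp.single_apply]
      refine Finset.sum_eq_zero fun a ha => Finset.sum_eq_zero fun b hb => if_neg ?_
      exact hg _ ⟨a, by simpa [s] using ha, rfl⟩ b (by simpa [t] using hb)
    rw [hmain, h1] at h2
    exact one_ne_zero h2
  have hB : B.ncard ≠ 0 := by
    obtain ⟨-, -, b, hb, -⟩ := h.cover 0
    exact (Set.ncard_pos (Set.toFinite B)).2 ⟨b, hb⟩ |>.ne'
  have hle : A.ncard * B.ncard ≤ ((fun a => q • a) '' A).ncard * B.ncard := by
    rw [h.ncard_mul_ncard, ← Set.ncard_prod]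
    have hu : (fun x : G × G => x.1 + x.2) '' (((fun a => q • a) '' A) ×ˢ B) = Set.univ := by
      refine Set.eq_univ_of_forall fun g => ?_
      obtain ⟨a, ha, b, hb, e⟩ := hcover g
      exact ⟨(a, b), ⟨ha, hb⟩, e⟩
    rw [← Set.ncard_univ, ← hu]
    exact Set.ncard_image_le (Set.toFinite _)
  have hcard : ((fun a => q • a) '' A).ncard = A.ncard :=
    le_antisymm (Set.ncard_image_le A.toFinite)
      (Nat.le_of_mul_le_mul_right hle (Nat.pos_of_ne_zero hB))
  exact ⟨Set.injOn_of_ncard_image_eq hcard A.toFinite,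
    .of_cover hcover (by rw [hcard, h.ncard_mul_ncard])⟩

/-- A factor may be replaced by its multiple by an integer prime to its size. -/
theorem IsFactorization.nsmul {A B : Set G} (h : IsFactorization A B) {k : ℕ} (hk : k ≠ 0)
    (hA : A.ncard.Coprime k) :
    Set.InjOn (fun a => k • a) A ∧ IsFactorization ((fun a => k • a) '' A) B := by
  induction k using Nat.recOnMul generalizing A with
  | zero => exact absurd rfl hk
  | one => exact ⟨fun a _ b _ e => by simpa using e, by simpa using h⟩
  | prime q hq => exact h.nsmul_prime hq hA
  | mul a b iha ihb =>
    have hb := ihb h (right_ne_zero_of_mul hk) (Nat.Coprime.coprime_mul_left_right hA)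
    have ha := iha hb.2 (left_ne_zero_of_mul hk)
      (by rw [hb.1.ncard_image]; exact Nat.Coprime.coprime_mul_right_right hA)
    have e : (fun x : G => (a * b) • x) = (fun x => a • x) ∘ fun x => b • x := by
      ext x; simp [mul_smul]
    rw [e, Set.image_comp]
    exact ⟨ha.1.comp hb.1 (Set.mapsTo_image _ _), ha.2⟩

end Replacement

/-! ### Periodic factors in cyclic `p`-groups -/

section CyclicPGroup

open Polynomial in
theorem ZMod.add_mem_of_sum_stdAddChar_eq_zero {p e : ℕ} [Fact p.Prime]
    (A : Finset (ZMod (p ^ (e + 1))))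
    (h : ∑ a ∈ A, ZMod.stdAddChar a = 0) (a : ZMod (p ^ (e + 1))) (ha : a ∈ A) :
    ((p ^ e : ℕ) : ZMod (p ^ (e + 1))) + a ∈ A := by
  classical
  have hN : 0 < p ^ (e + 1) := pow_pos (Fact.out : p.Prime).pos _
  let ζ : ℂ := Complex.exp (2 * Real.pi * Complex.I / (p ^ (e + 1) : ℕ))
  have hζ : IsPrimitiveRoot ζ (p ^ (e + 1)) := Complex.isPrimitiveRoot_exp _ hN.ne'
  have hval : ∀ a : ZMod (p ^ (e + 1)), ZMod.stdAddChar a = ζ ^ a.val := by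
    intro a
    have h1 := ZMod.stdAddChar_coe (N := p ^ (e + 1)) (a.val : ℤ)
    rw [Int.cast_natCast, ZMod.natCast_zmod_val] at h1
    rw [h1, ← Complex.exp_nat_mul]
    congr 1
    push_cast
    ring
  let F : ℤ[X] := ∑ a ∈ A, X ^ a.val
  have hF : aeval ζ F = 0 := by simpa [F, hval] using h
  have hdvd : cyclotomic (p ^ (e + 1)) ℤ ∣ F := by
    rw [cyclotomic_eq_minpoly hζ hN]
    exact minpoly.isIntegrallyClosed_dvd (hζ.isIntegral hN) hF
  obtain ⟨R, hR⟩ := hdvd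
  let φ : ℤ[X] →ₐ[ℤ] AddMonoidAlgebra ℤ (ZMod (p ^ (e + 1))) :=
    aeval (AddMonoidAlgebra.single 1 1)
  have hφ : ∀ k : ℕ, φ (X ^ k) = AddMonoidAlgebra.single (k : ZMod (p ^ (e + 1))) 1 := by
    intro k
    simp [φ, AddMonoidAlgebra.single_pow]
  -- `Φ_{p^(e+1)} * (X ^ p ^ e - 1) = X ^ p ^ (e + 1) - 1` dies in the group ring, so translation by
  -- `p ^ e` fixes the indicator of `A`.
  have hzero : φ (F * (X ^ p ^ e - 1)) = 0 := by
    rw [hR, mul_right_comm, cyclotomic_prime_pow_mul_X_pow_sub_one, map_mul, map_sub, hφ, map_one,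
      ZMod.natCast_self, AddMonoidAlgebra.one_def, sub_self, zero_mul]
  have hφF : φ F = ∑ a ∈ A, AddMonoidAlgebra.single a 1 := by
    simp only [F, map_sum, hφ, ZMod.natCast_zmod_val]
  rw [map_mul, map_sub, hφ, map_one, mul_sub, mul_one, sub_eq_zero, hφF, Finset.sum_mul] at hzero
  have h1 := congrArg (fun f => f.coeff (((p ^ e : ℕ) : ZMod (p ^ (e + 1))) + a)) hzero
  simp only [AddMonoidAlgebra.single_mul_single, mul_one, AddMonoidAlgebra.coeff_sum,
    Finsupp.finsetSum_apply, AddMonoidAlgebra.coeff_single, Finsupp.single_apply,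
    Finset.sum_ite_eq', add_comm _ (((p ^ e : ℕ) : ZMod (p ^ (e + 1)))), add_right_inj, ha,
    if_true] at h1
  by_contra hn
  rw [if_neg hn] at h1
  exact one_ne_zero h1

theorem ZMod.exists_nsmul_of_nsmul_eq_zero {p e : ℕ} (hp : p.Prime) (z : ZMod (p ^ (e + 1)))
    (hz : p • z = 0) : ∃ k : ℕ, z = k • ((p ^ e : ℕ) : ZMod (p ^ (e + 1))) := by
  have : NeZero (p ^ (e + 1)) := ⟨(pow_pos hp.pos _).ne'⟩
  rw [← ZMod.natCast_zmod_val z, nsmul_eq_mul, ← Nat.cast_mul, ZMod.natCast_eq_zero_iff] at hz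
  obtain ⟨k, hk⟩ : p ^ e ∣ z.val :=
    (mul_dvd_mul_iff_left hp.ne_zero).1 ((pow_succ' p e).symm.dvd.trans hz)
  exact ⟨k, by rw [← ZMod.natCast_zmod_val z, hk, nsmul_eq_mul, mul_comm, Nat.cast_mul]⟩

theorem IsFactorization.periodic_zmod {p e : ℕ} [Fact p.Prime] {A B : Set (ZMod (p ^ (e + 1)))}
    (h : IsFactorization A B) :
    (∀ z, p • z = 0 → z ∈ periodSubgroup A) ∨ (∀ z, p • z = 0 → z ∈ periodSubgroup B) := by
  classical
  have hp : p.Prime := Fact.out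
  have key : ∀ C : Set (ZMod (p ^ (e + 1))),
      ∑ c ∈ C.toFinite.toFinset, ZMod.stdAddChar c = 0 →
      ∀ z, p • z = 0 → z ∈ periodSubgroup C := by
    intro C hC z hz
    obtain ⟨k, rfl⟩ := ZMod.exists_nsmul_of_nsmul_eq_zero hp z hz
    refine nsmul_mem ((mem_periodSubgroup_of_finite C.toFinite).2 fun c hc => ?_) k
    simpa using ZMod.add_mem_of_sum_stdAddChar_eq_zero _ hC c (by simpa using hc)
  -- The product is the sum of a nontrivial character over the whole group.
  have hsum : (∑ a ∈ A.toFinite.toFinset, ZMod.stdAddChar a) *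
      (∑ b ∈ B.toFinite.toFinset, ZMod.stdAddChar b) = 0 := by
    have hne : (ZMod.stdAddChar : AddChar (ZMod (p ^ (e + 1))) ℂ) ≠ 1 := by
      intro h1
      have h2 : (1 : ZMod (p ^ (e + 1))) = 0 := by
        apply ZMod.injective_stdAddChar
        rw [h1]; rfl
      have : Fact (1 < p ^ (e + 1)) := ⟨Nat.one_lt_pow (by omega) hp.one_lt⟩
      exact one_ne_zero h2
    rw [← AddChar.sum_eq_zero_of_ne_one hne, Finset.sum_mul_sum, ← Finset.sum_product']
    refine Finset.sum_bij (fun x _ => x.1 + x.2) (fun _ _ => Finset.mem_univ _) ?_ ?_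
      (fun _ _ => (AddChar.map_add_eq_mul _ _ _).symm)
    · rintro ⟨a, b⟩ hab ⟨a', b'⟩ hab' e
      simp only [Finset.mem_product, Set.Finite.mem_toFinset] at hab hab'
      simp only at e
      obtain rfl := h.inj a hab.1 a' hab'.1 b hab.2 b' hab'.2 e
      rw [add_left_cancel e]
    · intro g _
      obtain ⟨a, ha, b, hb, e⟩ := h.cover g
      exact ⟨(a, b), by simp [ha, hb], e⟩
  exact (mul_eq_zero.1 hsum).imp (key A) (key B)

/-- In a factorization of a cyclic `p`-group one factor is periodic. -/
theorem IsFactorization.periodic_of_card_eq_pow {G : Type*} [AddCommGroup G] [IsAddCyclic G]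
    {p e : ℕ} (hp : p.Prime) (hG : Nat.card G = p ^ e) {A B : Set G} (h : IsFactorization A B) :
    (∀ z, p • z = 0 → z ∈ periodSubgroup A) ∨ (∀ z, p • z = 0 → z ∈ periodSubgroup B) := by
  have := Fact.mk hp
  cases e with
  | zero =>
    have := (Nat.card_eq_one_iff_unique.1 (hG.trans (pow_zero p))).1
    exact Or.inl fun z _ => by rw [Subsingleton.elim z 0]; exact zero_mem _
  | succ e =>
    let ε : ZMod (p ^ (e + 1)) ≃+ G := hG ▸ zmodAddCyclicAddEquiv (G := G) inferInstance
    have hf : Function.Surjective (ε.symm : G →+ ZMod (p ^ (e + 1))) := ε.symm.surjective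
    have hk : ∀ C : Set G, (ε.symm : G →+ ZMod (p ^ (e + 1))).ker ≤ periodSubgroup C := by
      intro C g hg
      have : g = 0 := by simpa using hg
      rw [this]
      exact zero_mem _
    have hC : ∀ C : Set G, (∀ z, p • z = 0 →
        z ∈ periodSubgroup ((ε.symm : G →+ ZMod (p ^ (e + 1))) '' C)) →
        ∀ z, p • z = 0 → z ∈ periodSubgroup C := by
      intro C hC z hz
      rw [← add_subgroup_eq_of_le_period (hk C), ← preimage_image_eq_add_ker,
        ← comap_periodSubgroup hf]
      exact hC _ (by rw [← map_nsmul, hz, map_zero])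
    exact (h.image hf (hk A)).periodic_zmod.imp (hC A) (hC B)

end CyclicPGroup

/-! ### Subgroups of a cyclic group are determined by their order -/

section Cyclic

variable {G : Type*} [AddCommGroup G] [Finite G] [IsAddCyclic G]

theorem IsAddCyclic.mem_addSubgroup_iff (C : AddSubgroup G) (g : G) :
    g ∈ C ↔ Nat.card C • g = 0 := by
  classical
  have := Fintype.ofFinite G
  refine ⟨fun hg => ?_, fun hg => ?_⟩
  · have := card_nsmul_eq_zero' (G := C) (x := ⟨g, hg⟩)
    exact congrArg Subtype.val this
  · have hsub : (C : Set G).toFinset ⊆ Finset.univ.filter fun a : G => Nat.card C • a = 0 := by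
      intro a ha
      have ha : a ∈ C := by simpa using ha
      have := card_nsmul_eq_zero' (G := C) (x := ⟨a, ha⟩)
      refine Finset.mem_filter.2 ⟨Finset.mem_univ _, ?_⟩
      exact congrArg Subtype.val this
    have hle : (Finset.univ.filter fun a : G => Nat.card C • a = 0).card ≤
        (C : Set G).toFinset.card := by
      refine (IsAddCyclic.card_nsmul_eq_zero_le Nat.card_pos).trans ?_
      rw [Set.toFinset_card, Nat.card_eq_fintype_card]
      exact le_of_eq rfl
    have := Finset.eq_of_subset_of_card_le hsub hle
    have hg' : g ∈ (C : Set G).toFinset := by rw [this]; simpa using hg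
    simpa using hg'

theorem IsAddCyclic.addSubgroup_eq_of_card_eq {C D : AddSubgroup G} (h : Nat.card C = Nat.card D) :
    C = D := by
  ext g
  rw [mem_addSubgroup_iff, mem_addSubgroup_iff, h]

end Cyclic

/-! ### Admissible series, and tilings obtained from them -/

section Series

variable {G Q : Type*} [AddCommGroup G] [AddCommGroup Q]

/-- The conditions on a series of subgroups `H 0 ≤ ⋯ ≤ H (2 * t)` that make `X` pyramidal, stated
for elements of `G`. -/
structure IsPyramidalChain (X : Set G) (t : ℕ) (H : ℕ → AddSubgroup G) : Prop where
  descend : ∀ i < t, ∀ x ∈ X, ∀ y ∈ X, x - y ∈ H (2 * i + 1) → x - y ∈ H (2 * i)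
  period : ∀ i < t, periodSubgroup (X + (H (2 * i + 1) : Set G)) = H (2 * i + 2)
  cover : X + (H (2 * t - 1) : Set G) = Set.univ

theorem quotSet_sub_inter_eq_zero_iff {X : Set G} (hX : X.Nonempty) {H K : AddSubgroup G}
    (hHK : H ≤ K) :
    (quotSet X H - quotSet X H) ∩ (quotSubgroup K H : Set (G ⧸ H)) = {0} ↔
      ∀ x ∈ X, ∀ y ∈ X, x - y ∈ K → x - y ∈ H := by
  constructor
  · intro h x hx y hy hxy
    have hm : QuotientAddGroup.mk' H (x - y) ∈
        (quotSet X H - quotSet X H) ∩ (quotSubgroup K H : Set (G ⧸ H)) :=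
      ⟨Set.mem_sub.2 ⟨_, ⟨x, hx, rfl⟩, _, ⟨y, hy, rfl⟩, (map_sub _ _ _).symm⟩, ⟨_, hxy, rfl⟩⟩
    rw [h, Set.mem_singleton_iff, ← AddMonoidHom.mem_ker, QuotientAddGroup.ker_mk'] at hm
    exact hm
  · intro h
    ext q
    rw [Set.mem_singleton_iff]
    constructor
    · rintro ⟨hq, k, hk, rfl⟩
      obtain ⟨_, ⟨x, hx, rfl⟩, _, ⟨y, hy, rfl⟩, e⟩ := Set.mem_sub.1 hq
      rw [← map_sub] at e
      rw [← e]
      have hd : x - y - k ∈ H := by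
        rw [← QuotientAddGroup.ker_mk' H, AddMonoidHom.mem_ker, map_sub, e, sub_self]
      have := h x hx y hy (by simpa using add_mem (hHK hd) hk)
      rwa [← AddMonoidHom.mem_ker, QuotientAddGroup.ker_mk']
    · rintro rfl
      obtain ⟨x, hx⟩ := hX
      exact ⟨Set.mem_sub.2 ⟨_, ⟨x, hx, rfl⟩, _, ⟨x, hx, rfl⟩, sub_self _⟩, zero_mem _⟩

theorem isPeriodicWith_quotSet_iff {X : Set G} {H K : AddSubgroup G} (hHK : H ≤ K) :
    IsPeriodicWith (quotSet X H) (quotSubgroup K H) ↔ periodSubgroup (X + (H : Set G)) = K := by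
  have hf := QuotientAddGroup.mk'_surjective H
  rw [IsPeriodicWith, ← (AddSubgroup.comap_injective hf).eq_iff, comap_periodSubgroup hf, quotSet,
    preimage_image_eq_add_ker, quotSubgroup, AddSubgroup.comap_map_eq, QuotientAddGroup.ker_mk',
    sup_eq_left.2 hHK]

theorem ncard_quotSet_eq_card_iff [Finite G] {X : Set G} {H : AddSubgroup G} :
    (quotSet X H).ncard = Nat.card (G ⧸ H) ↔ X + (H : Set G) = Set.univ := by
  have hf := QuotientAddGroup.mk'_surjective H
  rw [← Set.eq_univ_iff_ncard, ← (Set.preimage_injective.2 hf).eq_iff, quotSet,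
    preimage_image_eq_add_ker, QuotientAddGroup.ker_mk', Set.preimage_univ]

/-- The equalities `|X/H_{2i}| = |X/H_{2i+1}|` of T3 follow from T1, which makes the projection
injective on `X/H_{2i}`. -/
theorem pyramidalConditions_iff [Finite G] {X : Set G} (hX : X.Nonempty) {t : ℕ}
    {H : ℕ → AddSubgroup G} (hH : ∀ j < 2 * t, H j ≤ H (j + 1)) :
    PyramidalConditions X t H ↔ IsPyramidalChain X t H := by
  constructor
  · intro h
    refine ⟨fun i hi => ?_, fun i hi => ?_, ?_⟩
    · exact (quotSet_sub_inter_eq_zero_iff hX (hH _ (by omega))).1 (h.T1 i hi)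
    · exact (isPeriodicWith_quotSet_iff (hH _ (by omega))).1
        (h.T2 (i + 1) (by omega) (by omega))
    · exact ncard_quotSet_eq_card_iff.1 h.T3_top
  · intro h
    refine ⟨fun i hi => ?_, fun i hi hit => ?_, ?_, fun i hi => ?_⟩
    · exact (quotSet_sub_inter_eq_zero_iff hX (hH _ (by omega))).2 (h.descend i hi)
    · obtain ⟨i, rfl⟩ := Nat.exists_eq_add_of_le' hi
      exact (isPeriodicWith_quotSet_iff (hH (2 * i + 1) (by omega))).2 (h.period i (by omega))
    · exact ncard_quotSet_eq_card_iff.2 h.cover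
    · exact ncard_quotSet_eq (hH _ (by omega)) (h.descend i hi)

theorem isPyramidalChain_image_iff {f : G →+ Q} (hf : Function.Surjective f) {X : Set G} {t : ℕ}
    {H : ℕ → AddSubgroup G} (ht : 1 ≤ t) (hH : ∀ j ≤ 2 * t, f.ker ≤ H j) :
    IsPyramidalChain (f '' X) t (fun j => (H j).map f) ↔ IsPyramidalChain X t H := by
  have hcm : ∀ j ≤ 2 * t, ((H j).map f).comap f = H j := fun j hj => by
    rw [AddSubgroup.comap_map_eq, sup_eq_left.2 (hH j hj)]
  have hmem : ∀ j ≤ 2 * t, ∀ g, f g ∈ (H j).map f ↔ g ∈ H j := fun j hj g => by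
    rw [← AddSubgroup.mem_comap, hcm j hj]
  have hpre : ∀ j ≤ 2 * t, f ⁻¹' (f '' X + ((H j).map f : Set Q)) = X + (H j : Set G) :=
    fun j hj => by rw [preimage_image_add_subgroup, hcm j hj]
  have h1 : (∀ i < t, ∀ x ∈ f '' X, ∀ y ∈ f '' X, x - y ∈ (H (2 * i + 1)).map f →
      x - y ∈ (H (2 * i)).map f) ↔
      ∀ i < t, ∀ x ∈ X, ∀ y ∈ X, x - y ∈ H (2 * i + 1) → x - y ∈ H (2 * i) := by
    refine forall₂_congr fun i hi => ?_
    simp only [Set.forall_mem_image, ← map_sub, hmem (2 * i + 1) (by omega),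
      hmem (2 * i) (by omega)]
  have h2 : (∀ i < t, periodSubgroup (f '' X + ((H (2 * i + 1)).map f : Set Q)) =
      (H (2 * i + 2)).map f) ↔
      ∀ i < t, periodSubgroup (X + (H (2 * i + 1) : Set G)) = H (2 * i + 2) := by
    refine forall₂_congr fun i hi => ?_
    rw [← (AddSubgroup.comap_injective hf).eq_iff, comap_periodSubgroup hf,
      hpre (2 * i + 1) (by omega), hcm (2 * i + 2) (by omega)]
  have h3 : f '' X + ((H (2 * t - 1)).map f : Set Q) = Set.univ ↔
      X + (H (2 * t - 1) : Set G) = Set.univ := by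
    rw [← (Set.preimage_injective.2 hf).eq_iff, hpre (2 * t - 1) (by omega), Set.preimage_univ]
  exact ⟨fun h => ⟨h1.1 h.descend, h2.1 h.period, h3.1 h.cover⟩,
    fun h => ⟨h1.2 h.descend, h2.2 h.period, h3.2 h.cover⟩⟩

theorem series_le {t : ℕ} {H : ℕ → AddSubgroup G} (hlt : ∀ j, j + 1 < 2 * t → H j < H (j + 1))
    (hlast : H (2 * t) = ⊤) (j : ℕ) (hj : j < 2 * t) : H j ≤ H (j + 1) := by
  rcases (Nat.succ_le_of_lt hj).lt_or_eq with h | h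
  · exact (hlt j h).le
  · rw [show j + 1 = 2 * t from h, hlast]
    exact le_top

/-- The aperiodic and the periodic case merge: conditions on `X/H 0` in `G/H 0` pull back to the
same conditions in `G`. -/
theorem isAdmissibleSeries_iff [Finite G] {X : Set G} (hX : X.Nonempty) {t : ℕ}
    {H : ℕ → AddSubgroup G} :
    IsAdmissibleSeries X t H ↔ 1 ≤ t ∧ (∀ j, j + 1 < 2 * t → H j < H (j + 1)) ∧
      H (2 * t) = ⊤ ∧ periodSubgroup X = H 0 ∧ IsPyramidalChain X t H := by
  have hmono : (∀ j, j + 1 < 2 * t → H j < H (j + 1)) → H (2 * t) = ⊤ →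
      ∀ j ≤ 2 * t, H 0 ≤ H j := by
    intro h1 h2 j hj
    induction j with
    | zero => exact le_rfl
    | succ j ih => exact (ih (by omega)).trans (series_le h1 h2 j (by omega))
  have hker : ∀ j, (QuotientAddGroup.mk' (H 0)).ker ≤ H j ↔ H 0 ≤ H j := fun j => by
    rw [QuotientAddGroup.ker_mk']
  have hconv : 1 ≤ t → (∀ j, j + 1 < 2 * t → H j < H (j + 1)) → H (2 * t) = ⊤ →
      (PyramidalConditions (quotSet X (H 0)) t (fun j => quotSubgroup (H j) (H 0)) ↔
        IsPyramidalChain X t H) := by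
    intro ht h1 h2
    refine (pyramidalConditions_iff (hX.image _)
      (fun j hj => AddSubgroup.map_mono (series_le h1 h2 j hj))).trans ?_
    exact isPyramidalChain_image_iff (QuotientAddGroup.mk'_surjective (H 0)) ht
      (fun j hj => (hker j).2 (hmono h1 h2 j hj))
  constructor
  · rintro ⟨ht, h1, -, h2, h3 | h3⟩
    · exact ⟨ht, h1, h2, h3.2.1.trans h3.1.symm,
        (pyramidalConditions_iff hX (series_le h1 h2)).1 h3.2.2⟩
    · exact ⟨ht, h1, h2, h3.2.1, (hconv ht h1 h2).1 h3.2.2⟩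
  · rintro ⟨ht, h1, h2, h3, h4⟩
    refine ⟨ht, h1, h2 ▸ le_top, h2, ?_⟩
    by_cases h0 : H 0 = ⊥
    · exact Or.inl ⟨h0, h3.trans h0, (pyramidalConditions_iff hX (series_le h1 h2)).2 h4⟩
    · exact Or.inr ⟨h0, h3, (hconv ht h1 h2).2 h4⟩

theorem IsPyramidalChain.tiles {X : Set G} {t : ℕ} {H : ℕ → AddSubgroup G} (ht : 1 ≤ t)
    (hH : ∀ j < 2 * t, H j ≤ H (j + 1)) (h : IsPyramidalChain X t H) {i : ℕ} (hi : i ≤ t) :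
    Tiles (X + (H (2 * i) : Set G)) := by
  induction hi using Nat.decreasingInduction with
  | self =>
    convert tiles_univ
    rw [← add_subgroup_add_subgroup (H := H (2 * t - 1)), h.cover]
    · exact add_subgroup_eq_of_le_period (le_periodSubgroup_iff.2 fun _ _ _ _ => trivial)
    · have := hH (2 * t - 1) (by omega)
      rwa [Nat.sub_add_cancel (by omega)] at this
  | of_succ i hi ih =>
    refine Tiles.of_add_subgroup (hH (2 * i) (by omega)) (h.descend i hi) ?_
    -- Enlarging `H_{2i+1}` to `H_{2i+2}` adds only periods.
    rwa [add_subgroup_congr_of_le_period (hH (2 * i + 1) (by omega)) (h.period i hi).ge]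

end Series

/-! ### From a tiling to an admissible series -/

section TilesToSeries

variable {G : Type*} [AddCommGroup G] [Finite G]

/-- Identify `G` modulo the `q`-torsion with `q • G`. Then `A` becomes `q • A`, which has the
complement `B ∩ q • G`. -/
theorem IsFactorization.tiles_add_ker_nsmul {A B : Set G} (h : IsFactorization A B) {q : ℕ}
    (hq : q ≠ 0) (hA : A.ncard.Coprime q) :
    (∀ x ∈ A, ∀ y ∈ A, x - y ∈ (nsmulAddMonoidHom (α := G) q).ker → x = y) ∧
      Tiles (A + ((nsmulAddMonoidHom (α := G) q).ker : Set G)) := by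
  obtain ⟨hinj, hfac⟩ := h.nsmul hq hA
  refine ⟨fun x hx y hy hxy => hinj hx hy ?_, ?_⟩
  · rw [AddMonoidHom.mem_ker, map_sub, sub_eq_zero] at hxy
    exact hxy
  let f := (nsmulAddMonoidHom (α := G) q).rangeRestrict
  have hf : Function.Surjective f := AddMonoidHom.rangeRestrict_surjective _
  rw [← AddMonoidHom.ker_rangeRestrict, ← tiles_image_iff hf]
  refine ⟨Subtype.val ⁻¹' B, fun g => ?_, ?_⟩
  · obtain ⟨_, ⟨a, ha, rfl⟩, b, hb, e⟩ := hfac.cover g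
    have hb' : b ∈ (nsmulAddMonoidHom (α := G) q).range := by
      have : b = g - q • a := by rw [← e]; simp
      rw [this]
      exact sub_mem g.2 ⟨a, rfl⟩
    exact ⟨f a, ⟨a, ha, rfl⟩, ⟨b, hb'⟩, hb, Subtype.ext e⟩
  · rintro _ ⟨a, ha, rfl⟩ _ ⟨a', ha', rfl⟩ b hb b' hb' e
    exact Subtype.ext (hfac.inj _ ⟨a, ha, rfl⟩ _ ⟨a', ha', rfl⟩ b hb b' hb'
      (congrArg Subtype.val e))

theorem Tiles.exists_subgroup [IsAddCyclic G] [Nontrivial G] {p k : ℕ} (hp : p.Prime) {A : Set G}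
    (hA : A.ncard = p ^ k) (h : Tiles A) (hper : periodSubgroup A = ⊥) :
    ∃ H : AddSubgroup G, H ≠ ⊥ ∧ (∀ x ∈ A, ∀ y ∈ A, x - y ∈ H → x = y) ∧
      Tiles (A + (H : Set G)) := by
  obtain ⟨B, hB⟩ := h
  by_cases hq : ∃ q : ℕ, q.Prime ∧ q ∣ Nat.card G ∧ q ≠ p
  · obtain ⟨q, hq, hqG, hqp⟩ := hq
    have hcop : A.ncard.Coprime q := by
      rw [hA]
      exact ((Nat.coprime_primes hp hq).2 hqp.symm).pow_left k
    refine ⟨_, ?_, hB.tiles_add_ker_nsmul hq.ne_zero hcop⟩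
    have := Fact.mk hq
    obtain ⟨x, hx⟩ := exists_prime_addOrderOf_dvd_card' q hqG
    intro hbot
    have hx0 : x ∈ (nsmulAddMonoidHom (α := G) q).ker := by
      rw [AddMonoidHom.mem_ker, nsmulAddMonoidHom_apply, ← hx, addOrderOf_nsmul_eq_zero]
    rw [hbot, AddSubgroup.mem_bot] at hx0
    rw [hx0, addOrderOf_zero] at hx
    exact hq.one_lt.ne hx
  · push Not at hq
    have hcard := Nat.eq_prime_pow_of_unique_prime_dvd (p := p) (n := Nat.card G)
      Nat.card_pos.ne' (fun hd hdG => hq _ hd hdG)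
    have hpG : p ∣ Nat.card G := by
      obtain ⟨q, hqp, hqG⟩ := Nat.exists_prime_and_dvd (Finite.one_lt_card (α := G)).ne'
      exact hq q hqp hqG ▸ hqG
    have := Fact.mk hp
    obtain ⟨x, hx⟩ := exists_prime_addOrderOf_dvd_card' p hpG
    have hpx : p • x = 0 := by rw [← hx, addOrderOf_nsmul_eq_zero]
    have hx0 : x ≠ 0 := by
      rintro rfl
      rw [addOrderOf_zero] at hx
      exact hp.one_lt.ne hx
    rcases hB.periodic_of_card_eq_pow hp hcard with h | h
    · have := h x hpx
      rw [hper, AddSubgroup.mem_bot] at this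
      exact absurd this hx0
    · have hf := QuotientAddGroup.mk'_surjective (periodSubgroup B)
      have hk : (QuotientAddGroup.mk' (periodSubgroup B)).ker ≤ periodSubgroup B := by
        rw [QuotientAddGroup.ker_mk']
      refine ⟨periodSubgroup B, fun hb => hx0 ?_, fun a ha a' ha' hd => ?_, ?_⟩
      · rw [← AddSubgroup.mem_bot, ← hb]
        exact h x hpx
      · exact hB.injOn_of_ker_le hk ha ha' (QuotientAddGroup.eq_iff_sub_mem.2 hd)
      · rw [← QuotientAddGroup.ker_mk' (periodSubgroup B), ← tiles_image_iff hf]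
        exact ⟨_, (hB.symm.image hf hk).symm⟩

theorem Tiles.exists_subgroup_gt [IsAddCyclic G] {p k : ℕ} (hp : p.Prime) {X : Set G}
    {H : AddSubgroup G} (hH : H ≠ ⊤) (hX : (quotSet X H).ncard = p ^ k)
    (h : Tiles (X + (H : Set G))) (hper : periodSubgroup (X + (H : Set G)) = H) :
    ∃ K : AddSubgroup G, H < K ∧ (∀ x ∈ X, ∀ y ∈ X, x - y ∈ K → x - y ∈ H) ∧
      Tiles (X + (K : Set G)) := by
  have hf := QuotientAddGroup.mk'_surjective H
  have hnt : Nontrivial (G ⧸ H) := by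
    obtain ⟨g, hg⟩ := SetLike.exists_not_mem_of_ne_top H hH
    exact ⟨⟨g, 0, fun e => hg ((QuotientAddGroup.eq_zero_iff g).1 e)⟩⟩
  have hcyc : IsAddCyclic (G ⧸ H) := isAddCyclic_of_surjective _ hf
  have ht : Tiles (quotSet X H) := by
    rwa [quotSet, tiles_image_iff hf, QuotientAddGroup.ker_mk']
  have hp0 : periodSubgroup (quotSet X H) = ⊥ := by
    rw [← (AddSubgroup.comap_injective hf).eq_iff, comap_periodSubgroup hf, quotSet,
      preimage_image_eq_add_ker, QuotientAddGroup.ker_mk', hper, AddMonoidHom.comap_bot,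
      QuotientAddGroup.ker_mk']
  obtain ⟨L, hL, hinj, hT⟩ := ht.exists_subgroup hp hX hp0
  have hle : H ≤ L.comap (QuotientAddGroup.mk' H) := by
    intro g hg
    rw [AddSubgroup.mem_comap, QuotientAddGroup.mk'_apply, (QuotientAddGroup.eq_zero_iff g).2 hg]
    exact zero_mem L
  refine ⟨L.comap (QuotientAddGroup.mk' H), hle.lt_of_ne fun e => hL ?_,
    fun x hx y hy hxy => ?_, ?_⟩
  · rw [← (AddSubgroup.comap_injective hf).eq_iff, ← e, AddMonoidHom.comap_bot,
      QuotientAddGroup.ker_mk']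
  · rw [AddSubgroup.mem_comap, map_sub] at hxy
    exact QuotientAddGroup.eq_iff_sub_mem.1 (hinj _ ⟨x, hx, rfl⟩ _ ⟨y, hy, rfl⟩ hxy)
  · rwa [← preimage_image_add_subgroup, tiles_preimage_iff hf]

/-- Counting `X + K = X + L` twice shows that `|X/L|` divides `|X/K|`. This keeps the size a power
of `p` along the recursion. -/
theorem exists_ncard_quotSet_eq_pow {p k : ℕ} (hp : p.Prime) {X : Set G} {K L : AddSubgroup G}
    (hKL : K ≤ L) (hXL : X + (K : Set G) = X + (L : Set G)) (hK : (quotSet X K).ncard = p ^ k) :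
    ∃ k', (quotSet X L).ncard = p ^ k' := by
  obtain ⟨k', -, hk'⟩ : ∃ k' ≤ k, (quotSet X L).ncard = p ^ k' := by
    rw [← Nat.dvd_prime_pow hp, ← hK]
    obtain ⟨c, hc⟩ := AddSubgroup.card_dvd_of_le hKL
    refine ⟨c, Nat.eq_of_mul_eq_mul_right (Nat.card_pos (α := K)) ?_⟩
    rw [← ncard_add_subgroup, hXL, ncard_add_subgroup, hc]
    ring
  exact ⟨k', hk'⟩

theorem IsPyramidalChain.exists_cons {G : Type*} [AddCommGroup G] {X : Set G} {H K : AddSubgroup G} {t : ℕ}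
    {F : ℕ → AddSubgroup G} (hHK : H < K)
    (hinj : ∀ x ∈ X, ∀ y ∈ X, x - y ∈ K → x - y ∈ H)
    (hKL : K < periodSubgroup (X + (K : Set G))) (ht : 1 ≤ t)
    (hF0 : F 0 = periodSubgroup (X + (K : Set G))) (hFlt : ∀ j, j + 1 < 2 * t → F j < F (j + 1))
    (hFtop : F (2 * t) = ⊤) (hF : IsPyramidalChain X t F) :
    ∃ F' : ℕ → AddSubgroup G, F' 0 = H ∧ (∀ j, j + 1 < 2 * (t + 1) → F' j < F' (j + 1)) ∧
      F' (2 * (t + 1)) = ⊤ ∧ IsPyramidalChain X (t + 1) F' := by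
  refine ⟨fun j => if j = 0 then H else if j = 1 then K else F (j - 2), rfl, ?_, hFtop, ?_, ?_, ?_⟩
  · intro j hj
    match j with
    | 0 => exact hHK
    | 1 =>
      change K < F 0
      rwa [hF0]
    | j + 2 => exact hFlt j (by omega)
  · intro i hi
    match i with
    | 0 => exact hinj
    | i + 1 => exact hF.descend i (by omega)
  · intro i hi
    match i with
    | 0 => exact hF0.symm
    | i + 1 => exact hF.period i (by omega)
  · obtain ⟨t, rfl⟩ := Nat.exists_eq_add_of_le' ht
    exact hF.cover

theorem Tiles.exists_chain [IsAddCyclic G] {p : ℕ} (hp : p.Prime) {X : Set G} (H : AddSubgroup G)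
    (hH : H ≠ ⊤) {k : ℕ} (hX : (quotSet X H).ncard = p ^ k) (h : Tiles (X + (H : Set G)))
    (hper : periodSubgroup (X + (H : Set G)) = H) :
    ∃ (t : ℕ) (F : ℕ → AddSubgroup G), 1 ≤ t ∧ F 0 = H ∧
      (∀ j, j + 1 < 2 * t → F j < F (j + 1)) ∧ F (2 * t) = ⊤ ∧ IsPyramidalChain X t F := by
  induction H using WellFoundedGT.induction generalizing k with
  | ind H ih =>
  let P : AddSubgroup G → Prop := fun K =>
    H < K ∧ (∀ x ∈ X, ∀ y ∈ X, x - y ∈ K → x - y ∈ H) ∧ Tiles (X + (K : Set G))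
  -- Maximality of `K` forces `X/K` to be periodic unless `K` is the whole group; the recursion
  -- continues from its periods `L`.
  obtain ⟨K, hK⟩ := (Set.toFinite {K | P K}).exists_maximal (h.exists_subgroup_gt hp hH hX hper)
  obtain ⟨hHK, hinj, hT⟩ : P K := hK.prop
  have hKc : (quotSet X K).ncard = p ^ k := by rw [← ncard_quotSet_eq hHK.le hinj, hX]
  set L := periodSubgroup (X + (K : Set G)) with hL
  have hKL : K ≤ L := le_periodSubgroup_add X K
  have hXL : X + (K : Set G) = X + (L : Set G) := add_subgroup_congr_of_le_period hKL le_rfl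
  by_cases hLtop : L = ⊤
  · refine ⟨1, fun j => if j = 0 then H else if j = 1 then K else ⊤, le_rfl, rfl, ?_, rfl, ?_, ?_,
      ?_⟩
    · intro j hj
      obtain rfl : j = 0 := by omega
      exact hHK
    · intro i hi
      obtain rfl : i = 0 := by omega
      exact hinj
    · intro i hi
      obtain rfl : i = 0 := by omega
      exact hL.symm.trans hLtop
    · change X + (K : Set G) = Set.univ
      obtain ⟨B, hB⟩ := hT
      obtain ⟨a, ha, -⟩ := hB.cover 0
      refine Set.eq_univ_of_forall fun g => ?_
      have := (mem_periodSubgroup.1 (hLtop ▸ AddSubgroup.mem_top (g - a) : g - a ∈ L) a).2 ha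
      simpa using this
  · have hKltL : K < L := by
      refine hKL.lt_of_ne fun e => ?_
      obtain ⟨K', hKK', hinj', hT'⟩ := hT.exists_subgroup_gt hp (e ▸ hLtop) hKc (hL.symm.trans e.symm)
      exact hK.not_gt (y := K') ⟨hHK.trans hKK', fun x hx y hy hxy =>
        hinj x hx y hy (hinj' x hx y hy hxy), hT'⟩ hKK'
    have hLper : periodSubgroup (X + (L : Set G)) = L := by rw [← hXL]
    obtain ⟨k', hk'⟩ := exists_ncard_quotSet_eq_pow hp hKL hXL hKc
    obtain ⟨t, F, ht, hF0, hFlt, hFtop, hF⟩ := ih L (hHK.trans hKltL) hLtop hk' (hXL ▸ hT) hLper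
    obtain ⟨F', hF'⟩ := hF.exists_cons hHK hinj hKltL ht hF0 hFlt hFtop
    exact ⟨t + 1, F', by omega, hF'⟩

end TilesToSeries

/-! ### When a subgroup is the only complement containing zero -/

section UniqueComplement

variable {G : Type*} [AddCommGroup G] [Finite G]

theorem exists_addOrderOf_eq_prime {p : ℕ} (hp : p.Prime) (h : p ∣ Nat.card G) :
    ∃ z : G, z ≠ 0 ∧ p • z = 0 := by
  have := Fact.mk hp
  obtain ⟨z, hz⟩ := exists_prime_addOrderOf_dvd_card' p h
  refine ⟨z, ?_, by rw [← hz, addOrderOf_nsmul_eq_zero]⟩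
  rintro rfl
  rw [addOrderOf_zero] at hz
  exact hp.one_lt.ne hz

theorem eq_zero_of_nsmul_eq_zero_of_coprime {G : Type*} [AddCommGroup G] {a b : ℕ} (h : a.Coprime b) {g : G} (ha : a • g = 0)
    (hb : b • g = 0) : g = 0 := by
  rw [← AddMonoid.addOrderOf_eq_one_iff, ← Nat.dvd_one, ← h]
  exact Nat.dvd_gcd (addOrderOf_dvd_of_nsmul_eq_zero ha) (addOrderOf_dvd_of_nsmul_eq_zero hb)

variable [IsAddCyclic G] {p ℓ : ℕ} {X D : Set G} {C : AddSubgroup G}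

/-- Here `C` is the `m`-torsion with `m` prime to `p`. If `D ≠ C`, some `D' = p ^ s • D` has `p • D'
⊆ C` but `D' ⊄ C`. For `z` of order `p`, translating `X` by `z` moves the `C`-components only by
periods of `D'`, so `z` is a period of `X + N` with `N = C ⊓ periodSubgroup D'`. Both `N < C` and `N
= C` are impossible. -/
theorem IsFactorization.eq_subgroup_of_not_dvd (hp : p.Prime) (hX : X.ncard = p ^ ℓ)
    (hC : IsFactorization X (C : Set G)) (hD : IsFactorization X D) (h0 : 0 ∈ D)
    (hpC : ¬ p ∣ Nat.card C)
    (hper : ∀ N < C, periodSubgroup (X + (N : Set G)) ≤ N) : D = C := by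
  by_contra hne
  set m := Nat.card C with hm
  have hm0 : m ≠ 0 := Nat.card_pos.ne'
  have hpm : p.Coprime m := (Nat.Prime.coprime_iff_not_dvd hp).2 hpC
  have hCm : ∀ g, g ∈ C ↔ m • g = 0 := IsAddCyclic.mem_addSubgroup_iff C
  have hG : p ^ ℓ * m = Nat.card G := by
    rw [← hC.ncard_mul_ncard, hX, hm, ← Nat.card_coe_set_eq]; rfl
  have hDm : D.ncard = m := by
    refine Nat.eq_of_mul_eq_mul_left (pow_pos hp.pos ℓ) ?_
    rw [hG, ← hX, hD.ncard_mul_ncard]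
  have hkill : ∀ g : G, (p ^ ℓ * m) • g = 0 := fun g => hG ▸ card_nsmul_eq_zero'
  have hex : ∃ s, ∀ d ∈ D, p ^ s • d ∈ C :=
    ⟨ℓ, fun d _ => by rw [hCm, smul_smul, mul_comm, hkill]⟩
  obtain ⟨s, hs, hs'⟩ : ∃ s, (∀ d ∈ D, p ^ (s + 1) • d ∈ C) ∧ ¬ ∀ d ∈ D, p ^ s • d ∈ C := by
    classical
    cases hfind : Nat.find hex with
    | zero =>
      have := Nat.find_spec hex
      simp only [hfind, pow_zero, one_smul] at this
      exact absurd (hD.eq_of_subset hC this) hne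
    | succ s =>
      exact ⟨s, hfind ▸ Nat.find_spec hex, Nat.find_min hex (by omega)⟩
  obtain ⟨hinj, hfac⟩ := hD.symm.nsmul (k := p ^ s) (pow_pos hp.pos s).ne'
    (hDm ▸ (hpm.pow_left s).symm)
  set D' := (fun d => p ^ s • d) '' D with hD'
  have hD'm : D'.ncard = m := by rw [hinj.ncard_image, hDm]
  have hpD' : ∀ d ∈ D', p • d ∈ C := by
    rintro _ ⟨d, hd, rfl⟩
    rw [smul_smul, ← pow_succ']
    exact hs d hd
  have hpG : p ∣ Nat.card G := by
    have : ℓ ≠ 0 := by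
      rintro rfl
      exact hs' fun d _ => by rw [hCm, smul_comm, ← one_mul m, ← pow_zero p, hkill, smul_zero]
    rw [← hG]
    exact (dvd_pow_self p this).mul_right m
  obtain ⟨z, hz0, hpz⟩ := exists_addOrderOf_eq_prime hp hpG
  have hzC : z ∉ C := fun h =>
    hz0 (eq_zero_of_nsmul_eq_zero_of_coprime hpm hpz ((hCm z).1 h))
  have hstable : ∀ x ∈ X, ∀ x' ∈ X, ∀ c ∈ C, z + x = x' + c → c ∈ periodSubgroup D' := by
    intro x hx x' hx' c hc e
    refine (mem_periodSubgroup_of_finite D'.toFinite).2 fun d hd => ?_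
    obtain ⟨-, hfacX⟩ := hfac.symm.nsmul hm0 (hX ▸ hpm.pow_left ℓ)
    -- Also `m • X` is a complement of `D'`. The claim is that the component of `c + d` in `m • X`
    -- vanishes; otherwise it has order `p`.
    obtain ⟨_, ⟨x₀, -, rfl⟩, d', hd', e'⟩ := hfacX.cover (c + d)
    by_cases hw : m • x₀ = 0
    · simp only [hw, zero_add] at e'
      exact e' ▸ hd'
    · exfalso
      set w := m • x₀ with hwdef
      have hwe : w = c + d - d' := by rw [← e']; abel
      have hpw : p • w = 0 := by
        have h1 : p ^ ℓ • w = 0 := by rw [hwdef, smul_smul, hkill]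
        have h2 : m • p • w = 0 := by
          rw [← hCm, hwe, smul_sub, smul_add]
          exact sub_mem (add_mem (C.nsmul_mem hc p) (hpD' d hd)) (hpD' d' hd')
        refine eq_zero_of_nsmul_eq_zero_of_coprime (hpm.pow_left ℓ) ?_ h2
        rw [smul_comm, h1, smul_zero]
      have hord : addOrderOf w = p :=
        ((Nat.dvd_prime hp).1 (addOrderOf_dvd_of_nsmul_eq_zero hpw)).resolve_left
          (fun h => hw (AddMonoid.addOrderOf_eq_one_iff.1 h))
      have hzw : z ∈ AddSubgroup.zmultiples w := by
        rw [IsAddCyclic.mem_addSubgroup_iff, Nat.card_zmultiples, hord, hpz]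
      obtain ⟨r, hr⟩ := mem_multiples_iff_mem_zmultiples.2 hzw
      have hr : r • w = z := hr
      -- This `j` fixes `C` pointwise and sends `w` to `z`. Being prime to `m`, it leaves `j • D'` a
      -- complement of `X`, where `x + j • d = x' + j • d'` forces `x = x'` and hence `z = c ∈ C`.
      obtain ⟨j, hj1, hjr⟩ := Nat.chineseRemainder hpm.symm 1 r
      have hjw : j • w = z := by
        rw [← hr, nsmul_eq_nsmul_iff_modEq, hord]
        exact hjr
      have hjc : j • c = c := by
        conv_rhs => rw [← one_smul ℕ c]
        rw [nsmul_eq_nsmul_iff_modEq]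
        exact hj1.of_dvd (addOrderOf_dvd_of_nsmul_eq_zero ((hCm c).1 hc))
      have hj0 : j ≠ 0 := by
        rintro rfl
        exact hz0 (by rw [← hjw, zero_smul])
      have hjm : D'.ncard.Coprime j := by
        rw [hD'm, Nat.Coprime, Nat.gcd_comm, hj1.gcd_eq, Nat.gcd_one_left]
      obtain ⟨-, hfacj⟩ := hfac.nsmul hj0 hjm
      have hxx : x = x' := by
        refine hfacj.symm.inj x hx x' hx' _ ⟨d, hd, rfl⟩ _ ⟨d', hd', rfl⟩ ?_
        have h3 : j • d = z - c + j • d' := by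
          rw [← hjw]
          conv_rhs => rw [← hjc]
          rw [hwe, smul_sub, smul_add]
          abel
        simp only [h3]
        rw [show x + (z - c + j • d') = (z + x) - c + j • d' by abel, e]
        abel
      rw [hxx, add_comm] at e
      exact hzC (add_left_cancel e ▸ hc)
  rcases (inf_le_left : C ⊓ periodSubgroup D' ≤ C).lt_or_eq with hN | hN
  · refine hzC (hN.le (hper _ hN ?_))
    refine (mem_periodSubgroup_of_finite (Set.toFinite _)).2 fun b hb => ?_
    obtain ⟨x, hx, hbx⟩ := mem_add_subgroup.1 hb
    obtain ⟨x', hx', c, hc, e⟩ := hC.cover (z + x)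
    refine mem_add_subgroup.2 ⟨x', hx', ?_⟩
    have : z + b - x' = (b - x) + c := by
      rw [show z + b - x' = (b - x) + ((z + x) - x') by abel, ← e]
      abel
    rw [this]
    exact add_mem hbx ⟨hc, hstable x hx x' hx' c hc e.symm⟩
  · have hCD' : (C : Set G) ⊆ D' := by
      intro c hc
      have h0' : (0 : G) ∈ D' := ⟨0, h0, smul_zero _⟩
      simpa using le_periodSubgroup_iff.1 (inf_eq_left.1 hN) c hc 0 h0'
    have := hC.eq_of_subset hfac.symm hCD'
    refine hs' fun d hd => ?_
    have hmem : p ^ s • d ∈ D' := ⟨d, hd, rfl⟩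
    rwa [← this] at hmem

/-- With `m` the `p'`-part of `|G|`, replace `X` by `m • X`, which lies in the cyclic `p`-group `m •
G`. Every slice of `D` by a coset of `m • G` is then a complement of `m • X` there. If `m • X` were
periodic, so would be `X` modulo the `m`-torsion, which lies properly in `C`; hence all slices share
a period. -/
theorem IsFactorization.exists_period_of_dvd (hp : p.Prime) (hX : X.ncard = p ^ ℓ)
    (hC : IsFactorization X (C : Set G)) (hD : IsFactorization X D)
    (hpC : p ∣ Nat.card C) (hper : ∀ N < C, periodSubgroup (X + (N : Set G)) ≤ N) :
    ∃ z ≠ 0, z ∈ C ∧ z ∈ periodSubgroup D := by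
  have hG : p ^ ℓ * Nat.card C = Nat.card G := by
    rw [← hC.ncard_mul_ncard, hX, ← Nat.card_coe_set_eq]; rfl
  obtain ⟨e, m, hpm, hGm⟩ :=
    Nat.exists_eq_pow_mul_and_not_dvd (Nat.card_pos (α := G)).ne' p hp.ne_one
  replace hpm : p.Coprime m := (Nat.Prime.coprime_iff_not_dvd hp).2 hpm
  have hm0 : m ≠ 0 := by
    rintro rfl
    exact (Nat.card_pos (α := G)).ne' hGm
  obtain ⟨z, hz0, hpz⟩ := exists_addOrderOf_eq_prime hp (hG ▸ hpC.mul_left (p ^ ℓ))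
  have hmz : m • z ≠ 0 := fun h => hz0 (eq_zero_of_nsmul_eq_zero_of_coprime hpm hpz h)
  set f := nsmulAddMonoidHom (α := G) m with hf
  have hzC : z ∈ C := by
    obtain ⟨c, hc⟩ := hpC
    rw [IsAddCyclic.mem_addSubgroup_iff, hc, mul_comm, mul_smul, hpz, smul_zero]
  have hmC : m ∣ Nat.card C :=
    (hpm.pow_left ℓ).symm.dvd_of_dvd_mul_left (hG ▸ hGm ▸ Dvd.intro_left _ rfl)
  have hker : f.ker < C := by
    refine lt_of_le_of_ne (fun g hg => ?_) fun h => hmz (by rw [← h] at hzC; exact hzC)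
    obtain ⟨c, hc⟩ := hmC
    have hg : m • g = 0 := hg
    rw [IsAddCyclic.mem_addSubgroup_iff, hc, mul_comm, mul_smul, hg, smul_zero]
  have hrange : ∃ e', Nat.card f.range = p ^ e' := by
    refine ⟨_, Nat.eq_prime_pow_of_unique_prime_dvd Nat.card_pos.ne' fun {q} hq hqR => ?_⟩
    obtain ⟨⟨_, y, rfl⟩, hx0, hqx⟩ := exists_addOrderOf_eq_prime hq hqR
    by_contra hqp
    refine hx0 (eq_zero_of_nsmul_eq_zero_of_coprime
      (((Nat.coprime_primes hp hq).2 (Ne.symm hqp)).pow_left e) (Subtype.ext ?_) hqx)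
    change p ^ e • m • y = 0
    rw [smul_smul, ← hGm, card_nsmul_eq_zero']
  obtain ⟨e', he'⟩ := hrange
  obtain ⟨-, hfac⟩ := hD.nsmul hm0 (hX ▸ hpm.pow_left ℓ)
  let A : Set f.range := {r | (r : G) ∈ (fun x => m • x) '' X}
  let B : G → Set f.range := fun g => {r | (r : G) + g ∈ D}
  have hAB : ∀ g, IsFactorization A (B g) := by
    intro g
    refine ⟨fun r => ?_, fun a ha a' ha' b hb b' hb' e => ?_⟩
    · obtain ⟨a, ha, d, hd, e⟩ := hfac.cover (r + g)
      have haR : a ∈ f.range := by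
        obtain ⟨x, -, rfl⟩ := ha
        exact ⟨x, rfl⟩
      refine ⟨⟨a, haR⟩, ha, r - ⟨a, haR⟩, ?_, by abel⟩
      change (r : G) - a + g ∈ D
      rwa [show (r : G) - a + g = r + g - a by abel, ← e, add_sub_cancel_left]
    · refine Subtype.ext (hfac.inj _ ha _ ha' _ hb _ hb' ?_)
      have := congrArg Subtype.val e
      simp only [AddSubgroup.coe_add] at this
      rw [← add_assoc, this, add_assoc]
  let ζ : f.range := ⟨m • z, z, rfl⟩
  have hpζ : p • ζ = 0 := Subtype.ext (by
    change p • m • z = 0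
    rw [smul_comm, hpz, smul_zero])
  refine ⟨m • z, hmz, C.nsmul_mem hzC m, (mem_periodSubgroup_of_finite D.toFinite).2
    fun d hd => ?_⟩
  rcases (hAB d).periodic_of_card_eq_pow hp he' with h | h
  · refine absurd (hper _ hker ((mem_periodSubgroup_of_finite (Set.toFinite _)).2 fun b hb => ?_))
      (show z ∉ f.ker from hmz)
    obtain ⟨x, hx, hbx⟩ := mem_add_subgroup.1 hb
    obtain ⟨x', hx', e⟩ : m • z + m • x ∈ (fun x => m • x) '' X :=
      (mem_periodSubgroup.1 (h ζ hpζ) ⟨m • x, x, rfl⟩).2 ⟨x, hx, rfl⟩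
    refine mem_add_subgroup.2 ⟨x', hx', ?_⟩
    have h1 : z + x - x' ∈ f.ker := by
      change m • (z + x - x') = 0
      rw [smul_sub, smul_add, ← e, sub_self]
    have := add_mem h1 hbx
    rwa [show z + x - x' + (b - x) = z + b - x' by abel] at this
  · have h1 : (0 : f.range) ∈ B d := by
      change ((0 : f.range) : G) + d ∈ D
      simpa using hd
    have := (mem_periodSubgroup.1 (h ζ hpζ) 0).2 h1
    rw [add_zero] at this
    exact this

/-- If `X` has a subgroup `C` as a complement and every image of `X` modulo a proper subgroup of
`C` is aperiodic, then `C` is the only complement of `X` containing `0`. -/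
theorem IsFactorization.eq_subgroup (hp : p.Prime) (hX : X.ncard = p ^ ℓ)
    (hC : IsFactorization X (C : Set G)) (hD : IsFactorization X D) (h0 : 0 ∈ D)
    (hper : ∀ N < C, periodSubgroup (X + (N : Set G)) ≤ N) : D = C := by
  -- Modulo `K`, the image of `D` has no nonzero period in the image of `C`, which excludes the case
  -- where `p` divides the order of that image.
  let K := periodSubgroup D ⊓ C
  let f := QuotientAddGroup.mk' K
  have hf : Function.Surjective f := QuotientAddGroup.mk'_surjective K
  have hcyc : IsAddCyclic (G ⧸ K) := isAddCyclic_of_surjective _ hf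
  have hfk : f.ker = K := QuotientAddGroup.ker_mk' K
  have hKC : f.ker ≤ periodSubgroup (C : Set G) :=
    le_periodSubgroup_iff.2 fun h hh c hc => add_mem (hfk.le hh).2 hc
  have hKD : f.ker ≤ periodSubgroup D := hfk.le.trans inf_le_left
  have hCc : (C.map f).comap f = C := by
    rw [AddSubgroup.comap_map_eq, hfk, sup_eq_left.2 inf_le_right]
  have hCq : IsFactorization (f '' X) (C.map f : Set (G ⧸ K)) := (hC.symm.image hf hKC).symm
  have hDq : IsFactorization (f '' X) (f '' D) := (hD.symm.image hf hKD).symm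
  have hXq : (f '' X).ncard = p ^ ℓ := by rw [(hC.injOn_of_ker_le hKC).ncard_image, hX]
  have hperq : ∀ N < C.map f, periodSubgroup (f '' X + (N : Set (G ⧸ K))) ≤ N := by
    intro N hN
    have hlt : N.comap f < C :=
      ((AddSubgroup.comap_lt_comap_of_surjective hf).2 hN).trans_eq hCc
    rw [← AddSubgroup.comap_le_comap_of_surjective hf, comap_periodSubgroup hf,
      preimage_image_add_subgroup]
    exact hper _ hlt
  have hDD : f ⁻¹' (f '' D) = D := by
    rw [preimage_image_eq_add_ker, add_subgroup_eq_of_le_period hKD]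
  by_cases hpC : p ∣ Nat.card (C.map f)
  · obtain ⟨z, hz0, hzC, hzD⟩ := hCq.exists_period_of_dvd hp hXq hDq hpC hperq
    obtain ⟨z, rfl⟩ := hf z
    rw [← AddSubgroup.mem_comap, hCc] at hzC
    rw [← AddSubgroup.mem_comap, comap_periodSubgroup hf, hDD] at hzD
    exact absurd ((QuotientAddGroup.eq_zero_iff z).2 (show z ∈ K from ⟨hzD, hzC⟩)) hz0
  · have := hCq.eq_subgroup_of_not_dvd hp hXq hDq ⟨0, h0, map_zero f⟩ hpC hperq
    rw [← hDD, this, ← AddSubgroup.coe_comap, hCc]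

end UniqueComplement

/-! ### Several complements, and series of length greater than two -/

section Complements

variable {G : Type*} [AddCommGroup G]

theorem Tiles.exists_zero_mem {X : Set G} (h : Tiles X) : ∃ D, IsFactorization X D ∧ 0 ∈ D := by
  obtain ⟨B, hB⟩ := h
  obtain ⟨-, -, b, hb, -⟩ := hB.cover 0
  exact ⟨_, hB.translate (-b), b, hb, add_neg_cancel b⟩

/-- Each element of `B` may be moved by its own period of `A`, since `A` absorbs the shift. -/
theorem IsFactorization.perturb {A B : Set G} (h : IsFactorization A B) {φ : G → G}
    (hφ : ∀ b, φ b - b ∈ periodSubgroup A) : IsFactorization A (φ '' B) where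
  cover g := by
    obtain ⟨a, ha, b, hb, e⟩ := h.cover g
    exact ⟨-(φ b - b) + a, (mem_periodSubgroup.1 (neg_mem (hφ b)) a).2 ha, φ b, ⟨b, hb, rfl⟩,
      by rw [← e]; abel⟩
  inj := by
    rintro a ha a' ha' _ ⟨b, hb, rfl⟩ _ ⟨b', hb', rfl⟩ e
    obtain rfl := h.symm.inj b hb b' hb' _ ((mem_periodSubgroup.1 (hφ b) a).2 ha) _
      ((mem_periodSubgroup.1 (hφ b') a').2 ha') (by
        rw [show b + (φ b - b + a) = a + φ b by abel, e]; abel)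
    exact add_right_cancel e

theorem IsFactorization.add_subgroup {X B : Set G} {H : AddSubgroup G}
    (hX : ∀ x ∈ X, ∀ y ∈ X, x - y ∈ H → x = y) (h : IsFactorization (X + (H : Set G)) B) :
    IsFactorization X ((H : Set G) + B) where
  cover g := by
    obtain ⟨_, ⟨x, hx, k, hk, rfl⟩, b, hb, e⟩ := h.cover g
    exact ⟨x, hx, k + b, ⟨k, hk, b, hb, rfl⟩, by rw [← e, ← add_assoc]⟩
  inj := by
    rintro x hx x' hx' _ ⟨k, hk, b, hb, rfl⟩ _ ⟨k', hk', b', hb', rfl⟩ e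
    have e' := h.inj _ ⟨x, hx, k, hk, rfl⟩ _ ⟨x', hx', k', hk', rfl⟩ b hb b' hb'
      (by simpa only [add_assoc] using e)
    refine hX x hx x' hx' ?_
    have : x - x' = k' - k := by
      rw [sub_eq_sub_iff_add_eq_add]
      exact e'.trans (add_comm _ _)
    rw [this]
    exact sub_mem hk' hk

/-- An aperiodic set with a pyramidal chain of length greater than two has at least two
complements containing zero. -/
theorem IsPyramidalChain.exists_ne_complements {X : Set G} {t : ℕ} {H : ℕ → AddSubgroup G}
    (ht : 1 < t) (hlt : ∀ j, j + 1 < 2 * t → H j < H (j + 1)) (hlast : H (2 * t) = ⊤)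
    (h0 : H 0 = ⊥) (h : IsPyramidalChain X t H) :
    ∃ D D' : Set G, IsFactorization X D ∧ IsFactorization X D' ∧ 0 ∈ D ∧ 0 ∈ D' ∧ D ≠ D' := by
  classical
  have hinj : ∀ x ∈ X, ∀ y ∈ X, x - y ∈ H 1 → x = y := fun x hx y hy hxy => by
    have : x - y ∈ H 0 := h.descend 0 (by omega) x hx y hy hxy
    rwa [h0, AddSubgroup.mem_bot, sub_eq_zero] at this
  have h12 : H 1 < H 2 := hlt 1 (by omega)
  have h23 : H 2 < H 3 := hlt 2 (by omega)
  have hper : periodSubgroup (X + (H 1 : Set G)) = H 2 := h.period 0 (by omega)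
  have hXX : X + (H 1 : Set G) = X + (H 2 : Set G) :=
    add_subgroup_congr_of_le_period h12.le hper.ge
  obtain ⟨B, hB, hB0⟩ :=
    (h.tiles ht.le (series_le hlt hlast) (i := 1) (by omega)).exists_zero_mem
  rw [mul_one, ← hXX] at hB
  -- If `B = {0}`, then `X + H 2` is everything and T1 collapses `H 3` to `H 2`.
  obtain ⟨d, hd, hd0⟩ : ∃ d ∈ B, d ≠ 0 := by
    by_contra! hall
    refine h23.not_ge fun g hg => ?_
    obtain ⟨_, ⟨x, hx, -⟩, -⟩ := hB.cover 0
    obtain ⟨a, ha, b, hb, e⟩ := hB.cover (g + x)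
    rw [hall b hb, add_zero] at e
    rw [hXX, e, mem_add_subgroup] at ha
    obtain ⟨x', hx', hgx⟩ := ha
    have hxx : x - x' ∈ H 3 := by
      have := sub_mem (h23.le hgx) hg
      rwa [show g + x - x' - g = x - x' by abel] at this
    have := sub_mem hgx (h.descend 1 ht x hx x' hx' hxx)
    rwa [show g + x - x' - (x - x') = g by abel] at this
  obtain ⟨c, hc2, hc1⟩ := SetLike.exists_of_lt h12
  -- Moving only `d`, by a period of `X + H 1` outside `H 1`, changes `H 1 + B` but keeps `0`.
  let φ : G → G := fun b => if b = d then b + c else b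
  have hφ : IsFactorization (X + (H 1 : Set G)) (φ '' B) := hB.perturb fun b => by
    rw [hper]
    by_cases hb : b = d <;> simp [φ, hb, hc2, zero_mem]
  refine ⟨_, _, hB.add_subgroup hinj, hφ.add_subgroup hinj, ⟨0, zero_mem _, 0, hB0, add_zero 0⟩,
    ⟨0, zero_mem _, 0, ⟨0, hB0, if_neg hd0.symm⟩, add_zero 0⟩, fun e => ?_⟩
  have hmem : d ∈ (H 1 : Set G) + B := ⟨0, zero_mem _, d, hd, zero_add d⟩
  rw [e] at hmem
  obtain ⟨k, hk, _, ⟨b, hb, rfl⟩, e'⟩ := hmem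
  simp only [φ] at e'
  split_ifs at e' with hbd
  · refine hc1 ?_
    rw [hbd, show k + (d + c) = d + (k + c) by abel, add_eq_left] at e'
    rw [eq_neg_of_add_eq_zero_right e']
    exact neg_mem hk
  · obtain ⟨a, ha, -⟩ := hB.cover 0
    refine hbd (hB.symm.inj b hb d hd (k + a) ?_ a ha ?_)
    · exact (mem_periodSubgroup.1 (le_periodSubgroup_add X (H 1) hk) a).2 ha
    · rw [← e']
      abel

variable [Finite G] [IsAddCyclic G]

theorem Tiles.exists_series {p ℓ : ℕ} (hp : p.Prime) {X : Set G} (hX : X.ncard = p ^ ℓ)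
    (hne : X ≠ Set.univ) (h : Tiles X) :
    ∃ (t : ℕ) (H : ℕ → AddSubgroup G), IsAdmissibleSeries X t H := by
  have hX0 : X.Nonempty := by
    rw [← Set.ncard_pos X.toFinite, hX]
    exact pow_pos hp.pos ℓ
  have hXH : X + (periodSubgroup X : Set G) = X := add_subgroup_eq_of_le_period le_rfl
  have hbot : X + ((⊥ : AddSubgroup G) : Set G) = X := add_subgroup_eq_of_le_period bot_le
  have hXb : (quotSet X (⊥ : AddSubgroup G)).ncard = p ^ ℓ := by
    have := ncard_add_subgroup X (⊥ : AddSubgroup G)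
    rwa [hbot, AddSubgroup.card_bot, mul_one, hX, eq_comm] at this
  obtain ⟨k, hk⟩ := exists_ncard_quotSet_eq_pow hp (bot_le (a := periodSubgroup X))
    (hbot.trans hXH.symm) hXb
  obtain ⟨t, F, ht, hF0, hFlt, hFtop, hF⟩ := Tiles.exists_chain hp (periodSubgroup X)
    (fun htop => hne (Set.eq_univ_of_forall fun g => by
      obtain ⟨x, hx⟩ := hX0
      have := (mem_periodSubgroup.1 (htop ▸ AddSubgroup.mem_top (g - x)) x).2 hx
      rwa [sub_add_cancel] at this))
    hk (by rwa [hXH]) (by rw [hXH])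
  exact ⟨t, F, (isAdmissibleSeries_iff hX0).2 ⟨ht, hFlt, hFtop, hF0.symm, hF⟩⟩

/-- If the image of an aperiodic set `X` modulo a proper subgroup of a subgroup complement is
periodic, then `X` has an admissible series of length greater than two. -/
theorem IsFactorization.exists_long_series {p ℓ : ℕ} (hp : p.Prime) {X : Set G}
    (hX : X.ncard = p ^ ℓ) (hap : periodSubgroup X = ⊥) {C : AddSubgroup G}
    (hC : IsFactorization X (C : Set G)) {N : AddSubgroup G} (hN : N < C)
    (hper : ¬ periodSubgroup (X + (N : Set G)) ≤ N) :
    ∃ (t : ℕ) (H : ℕ → AddSubgroup G), 1 < t ∧ IsAdmissibleSeries X t H := by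
  have hf := QuotientAddGroup.mk'_surjective N
  have hkC : (QuotientAddGroup.mk' N).ker ≤ periodSubgroup (C : Set G) := by
    rw [QuotientAddGroup.ker_mk']
    exact le_periodSubgroup_iff.2 fun h hh c hc => add_mem (hN.le hh) hc
  have hTN : Tiles (X + (N : Set G)) := by
    rw [← QuotientAddGroup.ker_mk' N, ← tiles_image_iff hf]
    exact ⟨_, (hC.symm.image hf hkC).symm⟩
  have hX0 : X.Nonempty := by
    obtain ⟨x, hx, -⟩ := hC.cover 0
    exact ⟨x, hx⟩
  have hinjC : ∀ x ∈ X, ∀ y ∈ X, x - y ∈ C → x = y := fun x hx y hy hxy =>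
    hC.inj x hx y hy 0 (zero_mem C) _ hxy (by abel)
  have hXN : (quotSet X N).ncard = p ^ ℓ := by
    rw [quotSet, (hC.injOn_of_ker_le hkC).ncard_image, hX]
  have hle := le_periodSubgroup_add X N
  have hlt : N < periodSubgroup (X + (N : Set G)) := lt_of_le_not_ge hle hper
  have hXL : X + (N : Set G) = X + (periodSubgroup (X + (N : Set G)) : Set G) :=
    add_subgroup_congr_of_le_period hle le_rfl
  have hbot : ⊥ < N := by
    refine bot_lt_iff_ne_bot.2 ?_
    rintro rfl
    refine hper ?_
    rw [add_subgroup_eq_of_le_period bot_le, hap]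
  -- Otherwise `X + N` is everything, although `X + C` is direct and `N < C`.
  have htop : periodSubgroup (X + (N : Set G)) ≠ ⊤ := by
    intro htop
    refine hN.not_ge fun c hc => ?_
    obtain ⟨x, hx⟩ := hX0
    have := (mem_periodSubgroup.1 (htop ▸ AddSubgroup.mem_top c) x).2 (subset_add_subgroup X N hx)
    obtain ⟨x', hx', hcx⟩ := mem_add_subgroup.1 this
    have hxx : x' = x := by
      refine (hinjC x hx x' hx' ?_).symm
      have := sub_mem (hN.le hcx) hc
      rwa [show c + x - x' - c = x - x' by abel] at this
    rwa [hxx, add_sub_cancel_right] at hcx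
  obtain ⟨k, hk⟩ := exists_ncard_quotSet_eq_pow hp hle hXL hXN
  obtain ⟨t, F, ht, hF0, hFlt, hFtop, hF⟩ := Tiles.exists_chain hp _ htop hk (hXL ▸ hTN)
    (by rw [← hXL])
  -- Prepending `⊥ < N` to a chain that starts at the periods of `X + N` gives `t + 1 ≥ 2`.
  obtain ⟨F', hF0', hFlt', hFtop', hF'⟩ := hF.exists_cons (H := ⊥) hbot
    (fun x hx y hy hxy => by rw [hinjC x hx y hy (hN.le hxy), sub_self]; exact zero_mem _)
    hlt ht hF0 hFlt hFtop
  exact ⟨t + 1, F', by omega, (isAdmissibleSeries_iff hX0).2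
    ⟨by omega, hFlt', hFtop', hap.trans hF0'.symm, hF'⟩⟩

end Complements

/-! ### Perfect codes in circulant graphs as factorizations -/

section CirculantGraph

theorem isPerfectCode_circulantGraph_iff {G : Type*} [AddCommGroup G] {S : Set G} (hS : -S = S)
    {D : Set G} :
    IsPerfectCode (SimpleGraph.circulantGraph S) D ↔ IsFactorization (extendedSet S) D := by
  have hdist : ∀ v d, (SimpleGraph.circulantGraph S).edist v d ≤ (1 : ℕ) ↔
      v - d ∈ extendedSet S := by
    intro v d
    have hneg : d - v ∈ S ↔ v - d ∈ S := by
      conv_lhs => rw [← hS, Set.mem_neg, neg_sub]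
    rw [Nat.cast_one, SimpleGraph.edist_le_one_iff_adj_or_eq, SimpleGraph.circulantGraph_adj,
      hneg, or_self, extendedSet, Set.mem_insert_iff, sub_eq_zero]
    tauto
  simp only [IsPerfectCode, IsPerfectECode, hdist]
  constructor
  · refine fun h => ⟨fun g => ?_, fun a ha a' ha' b hb b' hb' e => ?_⟩
    · obtain ⟨d, ⟨hd, hg⟩, -⟩ := h g
      exact ⟨g - d, hg, d, hd, sub_add_cancel g d⟩
    · obtain rfl := (h (a + b)).unique ⟨hb, by simpa using ha⟩ ⟨hb', by simpa [e] using ha'⟩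
      exact add_right_cancel e
  · intro h v
    obtain ⟨a, ha, d, hd, rfl⟩ := h.cover v
    refine ⟨d, ⟨hd, by simpa using ha⟩, fun d' ⟨hd', hv⟩ => ?_⟩
    exact h.symm.inj d' hd' d hd _ hv a ha (by abel)

theorem ncard_extendedSet_of_isRegularOfDegree {G : Type*} [AddCommGroup G] [Finite G] {S : Set G}
    (hS0 : 0 ∉ S) (hS : -S = S) [(SimpleGraph.circulantGraph S).LocallyFinite] {k : ℕ}
    (h : (SimpleGraph.circulantGraph S).IsRegularOfDegree k) : (extendedSet S).ncard = k + 1 := by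
  have hN : (SimpleGraph.circulantGraph S).neighborSet 0 = S := by
    ext x
    have hneg : -x ∈ S ↔ x ∈ S := by
      conv_lhs => rw [← hS, Set.mem_neg, neg_neg]
    rw [SimpleGraph.mem_neighborSet, SimpleGraph.circulantGraph_adj, zero_sub, sub_zero, hneg,
      or_self, and_iff_right_iff_imp]
    rintro hx rfl
    exact hS0 hx
  rw [extendedSet, Set.ncard_insert_of_notMem hS0, ← h 0, ← SimpleGraph.card_neighborSet_eq_degree,
    ← Nat.card_eq_fintype_card, Nat.card_coe_set_eq, hN]

theorem extendedSet_ne_univ {G : Type*} [AddCommGroup G] {S : Set G}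
    (h : SimpleGraph.circulantGraph S ≠ ⊤) : extendedSet S ≠ Set.univ := by
  intro hu
  refine h ?_
  ext x y
  rw [SimpleGraph.circulantGraph_adj, SimpleGraph.top_adj, and_iff_left_iff_imp]
  intro hxy
  have : x - y ∈ extendedSet S := hu ▸ Set.mem_univ _
  rw [extendedSet, Set.mem_insert_iff, sub_eq_zero] at this
  exact Or.inl (this.resolve_left hxy)

end CirculantGraph

/-! ### The main theorem -/

theorem theorem1p2 (n : ℕ) (hn : 3 ≤ n) (p ℓ : ℕ) (hp : p.Prime) (hℓ : 1 ≤ ℓ)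
    (S : Set (ZMod n)) (hS0 : (0 : ZMod n) ∉ S) (hSneg : -S = S)
    [(SimpleGraph.circulantGraph S).LocallyFinite]
    (hconn : (SimpleGraph.circulantGraph S).Connected)
    (hnoncomplete : SimpleGraph.circulantGraph S ≠ ⊤)
    (hdeg : (SimpleGraph.circulantGraph S).IsRegularOfDegree (p ^ ℓ - 1)) :
    ((∃ D : Set (ZMod n), IsPerfectCode (SimpleGraph.circulantGraph S) D) ↔
      p ^ ℓ ∣ n ∧ IsPyramidal (extendedSet S)) ∧
    (p ^ ℓ ∣ n → IsPyramidal (extendedSet S) → IsAperiodicSet (extendedSet S) →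
      ∀ t : ℕ, IsLongestAdmissibleLength (extendedSet S) (2 * t) →
      -- part (a)
      ((extendedSet S - extendedSet S) ∩
          (AddSubgroup.zmultiples ((p ^ ℓ : ℕ) : ZMod n) : Set (ZMod n)) = {0} →
        IsPerfectCode (SimpleGraph.circulantGraph S)
          (AddSubgroup.zmultiples ((p ^ ℓ : ℕ) : ZMod n) : Set (ZMod n)) ∧
        (t = 1 → ∀ D : Set (ZMod n), IsPerfectCode (SimpleGraph.circulantGraph S) D →
          (0 : ZMod n) ∈ D →
          D = (AddSubgroup.zmultiples ((p ^ ℓ : ℕ) : ZMod n) : Set (ZMod n))) ∧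
        (1 < t → ∃ D : Set (ZMod n), IsPerfectCode (SimpleGraph.circulantGraph S) D ∧
          (0 : ZMod n) ∈ D ∧ ∀ K : AddSubgroup (ZMod n), D ≠ (K : Set (ZMod n)))) ∧
      -- part (b)
      ((extendedSet S - extendedSet S) ∩
          (AddSubgroup.zmultiples ((p ^ ℓ : ℕ) : ZMod n) : Set (ZMod n)) ≠ {0} →
        (∃ D : Set (ZMod n), IsPerfectCode (SimpleGraph.circulantGraph S) D ∧
          (0 : ZMod n) ∈ D) ∧
        ∀ K : AddSubgroup (ZMod n),
          ¬ IsPerfectCode (SimpleGraph.circulantGraph S) (K : Set (ZMod n)))) := by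
  have : NeZero n := ⟨by omega⟩
  have hcard : Nat.card (ZMod n) = n := Nat.card_zmod n
  have hpos : 0 < p ^ ℓ := pow_pos hp.pos ℓ
  have hX : (extendedSet S).ncard = p ^ ℓ := by
    rw [ncard_extendedSet_of_isRegularOfDegree hS0 hSneg hdeg, Nat.sub_add_cancel hpos]
  have hX0 : (0 : ZMod n) ∈ extendedSet S := Set.mem_insert 0 S
  have hXne : (extendedSet S).Nonempty := ⟨0, hX0⟩
  simp only [isPerfectCode_circulantGraph_iff hSneg]
  generalize hXdef : extendedSet S = X at *
  have hcardD : ∀ D, IsFactorization X D → p ^ ℓ * D.ncard = n := fun D hD => by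
    rw [← hX, hD.ncard_mul_ncard, hcard]
  have hcardK : ∀ K : AddSubgroup (ZMod n), IsFactorization X (K : Set (ZMod n)) →
      p ^ ℓ * Nat.card K = n := fun K hK => by
    refine Eq.trans ?_ (hcardD _ hK)
    rw [← Nat.card_coe_set_eq]
    rfl
  have htiles : IsPyramidal X → Tiles X := by
    rintro ⟨-, t, H, h⟩
    obtain ⟨ht, hlt, hlast, h0, hch⟩ := (isAdmissibleSeries_iff hXne).1 h
    have := hch.tiles ht (series_le hlt hlast) (Nat.zero_le t)
    rwa [mul_zero, ← h0, add_subgroup_eq_of_le_period le_rfl] at this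
  refine ⟨⟨?_, fun h => htiles h.2⟩, ?_⟩
  · rintro ⟨D, hD⟩
    exact ⟨⟨_, (hcardD D hD).symm⟩, hX0, Tiles.exists_series hp hX
      (hXdef ▸ extendedSet_ne_univ hnoncomplete) ⟨D, hD⟩⟩
  · intro hdvd hpyr hap t ht
    set C := AddSubgroup.zmultiples ((p ^ ℓ : ℕ) : ZMod n) with hCdef
    have hCcard : p ^ ℓ * Nat.card C = n := by
      rw [hCdef, Nat.card_zmultiples, ZMod.addOrderOf_coe _ (NeZero.ne n),
        Nat.gcd_eq_right hdvd, Nat.mul_div_cancel' hdvd]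
    obtain ⟨⟨t', F, htt, hF⟩, hmax⟩ := ht
    obtain rfl : t = t' := by omega
    refine ⟨fun hC => ?_, fun hC => ⟨(htiles hpyr).exists_zero_mem, fun K hK => hC ?_⟩⟩
    · have hCfac : IsFactorization X (C : Set (ZMod n)) := by
        refine .of_inj (fun a ha a' ha' b hb b' hb' e => ?_) ?_
        · have hmem : a - a' ∈ (X - X) ∩ (C : Set (ZMod n)) := by
            refine ⟨Set.sub_mem_sub ha ha', ?_⟩
            rw [show a - a' = b' - b by
              rw [sub_eq_sub_iff_add_eq_add, e, add_comm]]
            exact sub_mem hb' hb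
          rw [hC, Set.mem_singleton_iff, sub_eq_zero] at hmem
          exact hmem
        · rw [hX, hcard, ← Nat.card_coe_set_eq]
          exact hCcard
      refine ⟨hCfac, fun ht1 D hD h0 => hCfac.eq_subgroup hp hX hD h0 fun N hN => ?_,
        fun ht1 => ?_⟩
      · by_contra hper
        obtain ⟨t', H, ht', hH⟩ := hCfac.exists_long_series hp hX hap hN hper
        have := hmax ⟨t', H, rfl, hH⟩
        omega
      · obtain ⟨-, hlt, hlast, h0, hch⟩ := (isAdmissibleSeries_iff hXne).1 hF
        obtain ⟨D, D', hD, hD', h0D, h0D', hne⟩ :=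
          hch.exists_ne_complements ht1 hlt hlast (h0.symm.trans hap)
        -- Two subgroup codes would have equal order and so coincide; hence one of `D`, `D'` is not
        -- a subgroup.
        by_cases hK : ∃ K : AddSubgroup (ZMod n), D = K
        · obtain ⟨K, rfl⟩ := hK
          refine ⟨D', hD', h0D', fun K' hK' => hne ?_⟩
          subst hK'
          rw [IsAddCyclic.addSubgroup_eq_of_card_eq (C := K) (D := K')
            (Nat.eq_of_mul_eq_mul_left hpos ((hcardK K hD).trans (hcardK K' hD').symm))]
        · exact ⟨D, hD, h0D, not_exists.1 hK⟩
    · have hKC : K = C := IsAddCyclic.addSubgroup_eq_of_card_eq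
        (Nat.eq_of_mul_eq_mul_left hpos ((hcardK K hK).trans hCcard.symm))
      rw [hKC] at hK
      refine Set.Subset.antisymm ?_ ?_
      · rintro _ ⟨⟨x, hx, y, hy, rfl⟩, hxy⟩
        exact sub_eq_zero.2 (hK.inj x hx y hy 0 (zero_mem C) (x - y) hxy (by abel))
      · rintro _ rfl
        exact ⟨⟨0, hX0, 0, hX0, sub_self 0⟩, zero_mem C⟩
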